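/- Let $\mathbb E^5_1$ be $\mathbb R^5$ with the inner product $\langle v,w\rangle=-v_0w_0+v_1w_1+v_2w_2+v_3w_3+v_4w_4$, and let $\mathbb S^4_1(1)=\{v\in\mathbb E^5_1:\langle v,v\rangle=1\}$ be the de Sitter space-time. Let $M$ be an oriented smooth surface and $x:M\to\mathbb S^4_1(1)\subset\mathbb E^5_1$ a smooth space-like immersion (i.e. the induced metric is positive definite). Let $h$ be its second fundamental form in $\mathbb S^4_1(1)$, let $H=\frac12\operatorname{tr}h$ be its mean curvature vector, and let $D$ be the connection of its normal bundle in $\mathbb S^4_1(1)$. Let $\nu:M\to\Lambda^2(\mathbb E^5_1)$, $\nu=e_1\wedge e_2$ for any positively oriented orthonormal frame $e_1,e_2$ of the tangent planes, be the Gauss map, and let $\Delta=\sum_{i=1}^2(-e_ie_i+\nabla_{e_i}e_i)$ be the Laplace operator of the induced metric with Levi-Civita connection $\nabla$, acting componentwise on vector-valued maps. The surface is said to have pointwise 1-type Gauss map if there are a smooth function $f:M\to\mathbb R$ and a constant vector $C\in\Lambda^2(\mathbb E^5_1)$ such that $\Delta\nu=f(\nu+C)$ on $M$. Suppose that $H\neq0$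 at every point of $M$. Then $M$ has pointwise 1-type Gauss map if and only if $H$ is parallel, i.e. $D_vH=0$ for every tangent vector $v$ of $M$. -/

import Mathlib

open scoped Manifold ContDiff

noncomputable section

/-- The coordinate plane, on which surfaces are modelled. -/
abbrev Plane : Type := EuclideanSpace ℝ (Fin 2)

/-- The vector space underlying the Minkowski space of dimension 5 and index 1. -/
abbrev Mink : Type := Fin 5 → ℝ

/-- The indefinite inner product `-v₀w₀ + v₁w₁ + v₂w₂ + v₃w₃ + v₄w₄`. -/
def lor (v w : Mink) : ℝ := -(v 0 * w 0) + ∑ i : Fin 4, v i.succ * w i.succ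

/-- The unit de Sitter space-time `⟨v, v⟩ = 1`. -/
def deSitter : Set Mink := {v | lor v v = 1}

/-- The space of bivectors of Minkowski space (of dimension 10). -/
abbrev Bivector : Type := ⋀[ℝ]^2 Mink

/-- The bivector `v ∧ w`. -/
def wedge (v w : Mink) : Bivector := exteriorPower.ιMulti ℝ 2 ![v, w]

/-! ### Geometry of a parametrized surface `X : Plane → Mink` -/

/-- The partial derivative `∂ᵢφ`. -/
def pd {F : Type*} [NormedAddCommGroup F] [NormedSpace ℝ F] (i : Fin 2) (φ : Plane → F)
    (u : Plane) : F :=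
  fderiv ℝ φ u (EuclideanSpace.single i 1)

/-- The induced metric `gᵢⱼ = ⟨∂ᵢX, ∂ⱼX⟩`. -/
def metric (X : Plane → Mink) (u : Plane) : Matrix (Fin 2) (Fin 2) ℝ :=
  Matrix.of fun i j => lor (pd i X u) (pd j X u)

/-- The Christoffel symbols `Γᵏᵢⱼ` of the Levi-Civita connection of the induced metric. -/
def christoffel (X : Plane → Mink) (k i j : Fin 2) (u : Plane) : ℝ :=
  (1 / 2) * ∑ l, (metric X u)⁻¹ k l *
    (pd i (fun w => metric X w j l) u + pd j (fun w => metric X w i l) u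
      - pd l (fun w => metric X w i j) u)

/-- The Laplace operator of the induced metric, with the sign convention
`Δ = ∑ᵢ (-eᵢeᵢ + ∇_{eᵢ}eᵢ)`; in coordinates `Δφ = -gⁱʲ (∂ᵢ∂ⱼφ - Γᵏᵢⱼ ∂ₖφ)`. -/
def laplace (X : Plane → Mink) (φ : Plane → ℝ) (u : Plane) : ℝ :=
  -∑ i, ∑ j, (metric X u)⁻¹ i j * (pd i (pd j φ) u - ∑ k, christoffel X k i j u * pd k φ u)

/-- For `X` with values in de Sitter space: the component of `w` in the normal space of the
surface in de Sitter space, i.e. orthogonal to the position vector `X` and to `∂₀X`, `∂₁X`. -/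
def normalPart (X : Plane → Mink) (u : Plane) (w : Mink) : Mink :=
  w - lor w (X u) • X u - ∑ i, ∑ j, ((metric X u)⁻¹ i j * lor w (pd j X u)) • pd i X u

/-- The second fundamental form `h(∂ᵢ, ∂ⱼ)` of the surface in de Sitter space. -/
def secondForm (X : Plane → Mink) (i j : Fin 2) (u : Plane) : Mink :=
  normalPart X u (pd i (pd j X) u)

/-! ### Surfaces as immersions of a manifold -/

section Surface

variable {M : Type*} [TopologicalSpace M] [ChartedSpace Plane M]

variable (M) in
/-- `M` is oriented by its atlas: all coordinate changes have positive Jacobian determinant. -/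
def OrientedAtlas : Prop :=
  ∀ e ∈ atlas Plane M, ∀ e' ∈ atlas Plane M, ∀ u ∈ (e.symm.trans e').source,
    0 < (fderiv ℝ (e.symm.trans e') u).det

/-- `x` is a smooth space-like immersion of `M` in de Sitter space: the induced metric is
positive definite (so that `x` is in particular an immersion). -/
structure IsSpacelikeSurface (x : M → Mink) : Prop where
  smooth : ContMDiff (𝓡 2) 𝓘(ℝ, Mink) ∞ x
  mem_deSitter : ∀ p, x p ∈ deSitter
  pos : ∀ p (v : TangentSpace (𝓡 2) p), v ≠ 0 →
    0 < lor (mfderiv (𝓡 2) 𝓘(ℝ, Mink) x p v) (mfderiv (𝓡 2) 𝓘(ℝ, Mink) x p v)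

/-- A map on `M` read in the chart at `p`. The quantities below are independent of the choice of
coordinates, and are computed at `p` in this chart. -/
def inChart {F : Type*} (φ : M → F) (p : M) : Plane → F := φ ∘ (chartAt Plane p).symm

/-- The coordinates of `p` in the chart at `p`. -/
def coord (p : M) : Plane := chartAt Plane p p

/-- The mean curvature vector `H = (1/2) tr h` of the surface in de Sitter space. -/
def meanCurvature (x : M → Mink) (p : M) : Mink :=
  (1 / 2 : ℝ) • ∑ i, ∑ j, (metric (inChart x p) (coord p))⁻¹ i j •
    secondForm (inChart x p) i j (coord p)

/-- `H` is parallel in the normal bundle: `D_v H`, the normal component of the derivative of `H`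
along `v`, vanishes for every tangent vector `v`. -/
def HasParallelMeanCurvature (x : M → Mink) : Prop :=
  ∀ p (v : TangentSpace (𝓡 2) p),
    normalPart (inChart x p) (coord p)
      (mfderiv (𝓡 2) 𝓘(ℝ, Mink) (meanCurvature x) p v) = 0

/-- The Gauss map `p ↦ e₁ ∧ e₂`, the unit bivector of the oriented tangent plane at `p`, written
as `(det g)^(-1/2) ∂₀x ∧ ∂₁x`; see `gaussMap_eq_wedge`. -/
def gaussMap (x : M → Mink) (p : M) : Bivector :=
  (√(metric (inChart x p) (coord p)).det)⁻¹ •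
    wedge (pd 0 (inChart x p) (coord p)) (pd 1 (inChart x p) (coord p))

/-- `Δφ = w` at `p`, for a map `φ` with values in a finite-dimensional vector space, on which the
Laplace operator of the surface `x` acts componentwise. -/
def LaplaceEqAt {V : Type*} [AddCommGroup V] [Module ℝ V] (x : M → Mink) (φ : M → V) (p : M)
    (w : V) : Prop :=
  ∀ ℓ : Module.Dual ℝ V, laplace (inChart x p) (inChart (fun q => ℓ (φ q)) p) (coord p) = ℓ w

/-- The surface has pointwise 1-type Gauss map: `Δν = f (ν + C)` for a smooth function `f` and a
constant bivector `C`. -/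
def HasPointwiseOneTypeGaussMap (x : M → Mink) : Prop :=
  ∃ f : M → ℝ, ContMDiff (𝓡 2) 𝓘(ℝ, ℝ) ∞ f ∧ ∃ C : Bivector,
    ∀ p, LaplaceEqAt x (gaussMap x) p (f p • (gaussMap x p + C))

theorem mfderiv_eq_pd {x : M → Mink} (hx : ContMDiff (𝓡 2) 𝓘(ℝ, Mink) ∞ x) (p : M)
    (v : TangentSpace (𝓡 2) p) :
    mfderiv (𝓡 2) 𝓘(ℝ, Mink) x p v =
      (show Plane from v) 0 • pd 0 (inChart x p) (coord p) +
      (show Plane from v) 1 • pd 1 (inChart x p) (coord p) := by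
  have hd : MDifferentiableAt (𝓡 2) 𝓘(ℝ, Mink) x p :=
    (hx p).mdifferentiableAt (by simp)
  have h1 : mfderiv (𝓡 2) 𝓘(ℝ, Mink) x p v =
      fderiv ℝ (inChart x p) (coord p) (show Plane from v) := by
    rw [hd.mfderiv]
    simp [writtenInExtChartAt, inChart, coord, fderivWithin_univ, extChartAt]
    rfl
  have h2 : (show Plane from v) =
      (show Plane from v) 0 • (EuclideanSpace.single 0 1 : Plane) +
      (show Plane from v) 1 • (EuclideanSpace.single 1 1 : Plane) := by
    ext i
    fin_cases i <;> simp
  rw [h1]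
  conv_lhs => rw [h2]
  simp only [map_add, map_smul]
  rfl

/-- `gaussMap` is the Gauss map: for every positively oriented orthonormal basis `e₁, e₂` of the
tangent space at `p` (in the chart at `p`, which is an oriented chart), it is `e₁ ∧ e₂`. -/
theorem gaussMap_eq_wedge {x : M → Mink} (hx : IsSpacelikeSurface x) (p : M)
    (e₁ e₂ : TangentSpace (𝓡 2) p)
    (h11 : lor (mfderiv (𝓡 2) 𝓘(ℝ, Mink) x p e₁) (mfderiv (𝓡 2) 𝓘(ℝ, Mink) x p e₁) = 1)
    (h12 : lor (mfderiv (𝓡 2) 𝓘(ℝ, Mink) x p e₁) (mfderiv (𝓡 2) 𝓘(ℝ, Mink) x p e₂) = 0)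
    (h22 : lor (mfderiv (𝓡 2) 𝓘(ℝ, Mink) x p e₂) (mfderiv (𝓡 2) 𝓘(ℝ, Mink) x p e₂) = 1)
    (hpos : 0 < (show Plane from e₁) 0 * (show Plane from e₂) 1 -
      (show Plane from e₁) 1 * (show Plane from e₂) 0) :
    gaussMap x p =
      wedge (mfderiv (𝓡 2) 𝓘(ℝ, Mink) x p e₁) (mfderiv (𝓡 2) 𝓘(ℝ, Mink) x p e₂) := by
  rw [mfderiv_eq_pd hx.smooth] at h11 h12 h22 ⊢
  rw [mfderiv_eq_pd hx.smooth] at h12 ⊢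
  generalize ha : (show Plane from e₁) 0 = a at *
  generalize hb : (show Plane from e₁) 1 = b at *
  generalize hc : (show Plane from e₂) 0 = c at *
  generalize hd : (show Plane from e₂) 1 = d at *
  unfold gaussMap
  have hdet : (metric (inChart x p) (coord p)).det =
      lor (pd 0 (inChart x p) (coord p)) (pd 0 (inChart x p) (coord p)) *
      lor (pd 1 (inChart x p) (coord p)) (pd 1 (inChart x p) (coord p)) -
      lor (pd 0 (inChart x p) (coord p)) (pd 1 (inChart x p) (coord p)) *
      lor (pd 1 (inChart x p) (coord p)) (pd 0 (inChart x p) (coord p)) := by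
    simp [Matrix.det_fin_two, metric]
  rw [hdet]
  generalize pd 0 (inChart x p) (coord p) = P at *
  generalize pd 1 (inChart x p) (coord p) = Q at *
  have hlor : ∀ s t s' t' : ℝ, lor (s • P + t • Q) (s' • P + t' • Q) =
      s * s' * lor P P + s * t' * lor P Q + t * s' * lor Q P + t * t' * lor Q Q := by
    intro s t s' t'
    simp [lor, Fin.sum_univ_succ]
    ring
  have hsymm : lor Q P = lor P Q := by simp [lor, mul_comm]
  rw [hlor, hsymm] at h11 h12 h22
  rw [hsymm]
  have key : (a * d - b * c) ^ 2 * (lor P P * lor Q Q - lor P Q * lor P Q) = 1 := by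
    linear_combination (c * c * lor P P + 2 * c * d * lor P Q + d * d * lor Q Q) * h11 + h22 -
      (a * c * lor P P + a * d * lor P Q + b * c * lor P Q + b * d * lor Q Q) * h12
  have hs : (√(lor P P * lor Q Q - lor P Q * lor P Q))⁻¹ = a * d - b * c := by
    have hz : lor P P * lor Q Q - lor P Q * lor P Q = ((a * d - b * c)⁻¹) ^ 2 := by
      field_simp
      linarith
    rw [hz, Real.sqrt_sq (inv_nonneg.mpr hpos.le), inv_inv]
  rw [hs]
  have hw : ∀ v, wedge v v = 0 := fun v =>
    AlternatingMap.map_eq_zero_of_eq _ ![v, v] (i := 0) (j := 1) rfl (by simp)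
  have hadd1 : ∀ u v w, wedge (u + v) w = wedge u w + wedge v w := fun u v w => by
    simpa [wedge] using (exteriorPower.ιMulti ℝ 2 (M := Mink)).map_vecCons_add (m := ![w]) (x := u) (y := v)
  have hsm1 : ∀ (s : ℝ) u w, wedge (s • u) w = s • wedge u w := fun s u w => by
    simpa [wedge] using (exteriorPower.ιMulti ℝ 2 (M := Mink)).map_vecCons_smul (m := ![w]) (c := s) (x := u)
  have hanti : ∀ u w, wedge u w = - wedge w u := fun u w => by
    have := (exteriorPower.ιMulti ℝ 2 (M := Mink)).map_swap ![w, u] (i := 0) (j := 1) (by simp)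
    rw [wedge, wedge, ← this]
    congr 1
    ext i
    fin_cases i <;> rfl
  have hadd2 : ∀ u v w, wedge w (u + v) = wedge w u + wedge w v := fun u v w => by
    rw [hanti, hadd1, hanti u, hanti v, neg_add, neg_neg, neg_neg]
  have hsm2 : ∀ (s : ℝ) u w, wedge w (s • u) = s • wedge w u := fun s u w => by
    rw [hanti, hsm1, hanti u, smul_neg, neg_neg]
  simp only [hadd1, hadd2, hsm1, hsm2, hw]
  rw [hanti Q P]
  module

end Surface

end

/-! Everything rests on one formula, `laplace_gaussForm`. Write n for the unit tangent bivector, s =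
(det g)^(-1/2), h for the second fundamental form, and D for the normal connection. Then Δn = (|h|²
+ 2) n - 2s (D₀H ∧ ∂₁X + ∂₀X ∧ D₁H + gⁱʲ hᵢ₀ ∧ hⱼ₁). The first term is tangent ∧ tangent, the next
two are tangent ∧ normal, and the last is normal ∧ normal and represents the normal curvature. No
term involves the position vector X. The formula is proved after contraction with an arbitrary
alternating form η, so that only scalar functions are differentiated.

If H is parallel, the DH terms vanish. Commuting the second derivatives of H shows that the normal
curvature annihilates H (`ricci_of_parallel`). The normal space is a plane and H ≠ 0, so the
curvature term itself vanishes (`sum_inv_mul_form_eq_zero`); this also covers light-like H. Hence Δn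
= f n with f = |h|² + 2 and C = 0.

Conversely, let Δn = f (n + C). Pairing with x ∧ b gives f ⟨C, x ∧ b⟩ = 0 for every b, because x is
orthogonal to all terms of the formula (`lorDual_self_eq_zero`). Where f ≠ 0 this can be
differentiated along the surface, so f ⟨C, ∂ₖx ∧ b⟩ = 0 everywhere. Pairing the equation with ∂ₖx ∧
ξ, ξ normal, now leaves only the DH terms. They form an invertible linear system with coefficients
from g, so DH = 0.

The definitions evaluate each quantity at p in the preferred chart at p. Differentiating it requires
nearby values in one fixed chart, hence the lemmas on coordinate changes. Orientation matters only
for the sign of the Gauss map. -/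

noncomputable section

open Filter Topology

/-! ### The inner product -/

/-- The inner product of Minkowski space as a continuous bilinear map. -/
def lorL : Mink →L[ℝ] Mink →L[ℝ] ℝ :=
  LinearMap.toContinuousBilinearMap <| LinearMap.mk₂ ℝ lor
    (fun u v w => by simp [lor, Fin.sum_univ_succ]; ring)
    (fun c v w => by simp [lor, Fin.sum_univ_succ]; ring)
    (fun u v w => by simp [lor, Fin.sum_univ_succ]; ring)
    (fun c v w => by simp [lor, Fin.sum_univ_succ]; ring)

theorem lorL_apply (v w : Mink) : lorL v w = lor v w := rfl

theorem lor_comm (v w : Mink) : lor v w = lor w v := by simp [lor, mul_comm]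

@[simp] theorem lor_add_left (u v w : Mink) : lor (u + v) w = lor u w + lor v w := by
  simp [← lorL_apply]

@[simp] theorem lor_add_right (u v w : Mink) : lor u (v + w) = lor u v + lor u w := by
  simp [← lorL_apply]

@[simp] theorem lor_sub_left (u v w : Mink) : lor (u - v) w = lor u w - lor v w := by
  simp [← lorL_apply]

@[simp] theorem lor_sub_right (u v w : Mink) : lor u (v - w) = lor u v - lor u w := by
  simp [← lorL_apply]

@[simp] theorem lor_smul_left (c : ℝ) (v w : Mink) : lor (c • v) w = c * lor v w := by
  simp [← lorL_apply]

@[simp] theorem lor_smul_right (c : ℝ) (v w : Mink) : lor v (c • w) = c * lor v w := by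
  simp [← lorL_apply]

@[simp] theorem lor_zero_left (w : Mink) : lor 0 w = 0 := by
  simp [← lorL_apply]

@[simp] theorem lor_zero_right (w : Mink) : lor w 0 = 0 := by
  simp [← lorL_apply]

theorem lor_sum_left {ι : Type*} (s : Finset ι) (f : ι → Mink) (w : Mink) :
    lor (∑ i ∈ s, f i) w = ∑ i ∈ s, lor (f i) w := by
  simp [← lorL_apply]

theorem exists_lor_ne_zero {v : Mink} (hv : v ≠ 0) : ∃ w, lor v w ≠ 0 := by
  -- Flipping the time component turns the pairing with `v` into its Euclidean square norm.
  refine ⟨fun i => if i = 0 then -v 0 else v i, fun h => hv ?_⟩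
  simp [lor, Fin.sum_univ_succ] at h
  have hz : ∀ i, v i * v i = 0 := fun i => by
    fin_cases i <;> simp <;>
      nlinarith [mul_self_nonneg (v 0), mul_self_nonneg (v 1), mul_self_nonneg (v 2),
        mul_self_nonneg (v 3), mul_self_nonneg (v 4)]
  ext i
  exact mul_self_eq_zero.1 (hz i)

/-! ### Partial derivatives -/

section PartialDerivatives

variable {E F G : Type*} [NormedAddCommGroup E] [NormedSpace ℝ E] [NormedAddCommGroup F]
  [NormedSpace ℝ F] [NormedAddCommGroup G] [NormedSpace ℝ G] {u : Plane} {i j : Fin 2}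

theorem pd_congr {φ ψ : Plane → F} (h : φ =ᶠ[𝓝 u] ψ) : pd i φ u = pd i ψ u := by
  rw [pd, pd, h.fderiv_eq]

theorem pd_eventuallyEq {φ ψ : Plane → F} (h : φ =ᶠ[𝓝 u] ψ) : pd i φ =ᶠ[𝓝 u] pd i ψ :=
  h.fderiv.fun_comp fun L => L (EuclideanSpace.single i 1)

theorem pd_const (c : F) : pd i (fun _ => c) u = 0 := by simp [pd]

theorem pd_add {φ ψ : Plane → F} (hφ : DifferentiableAt ℝ φ u) (hψ : DifferentiableAt ℝ ψ u) :
    pd i (fun w => φ w + ψ w) u = pd i φ u + pd i ψ u := by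
  simp [pd, fderiv_fun_add hφ hψ]

theorem pd_sub {φ ψ : Plane → F} (hφ : DifferentiableAt ℝ φ u) (hψ : DifferentiableAt ℝ ψ u) :
    pd i (fun w => φ w - ψ w) u = pd i φ u - pd i ψ u := by
  simp [pd, fderiv_fun_sub hφ hψ]

theorem pd_sum {ι : Type*} {s : Finset ι} {φ : ι → Plane → F}
    (hφ : ∀ k ∈ s, DifferentiableAt ℝ (φ k) u) :
    pd i (fun w => ∑ k ∈ s, φ k w) u = ∑ k ∈ s, pd i (φ k) u := by
  simp [pd, fderiv_fun_sum hφ]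

theorem pd_bilin (β : E →L[ℝ] F →L[ℝ] G) {φ : Plane → E} {ψ : Plane → F}
    (hφ : DifferentiableAt ℝ φ u) (hψ : DifferentiableAt ℝ ψ u) :
    pd i (fun w => β (φ w) (ψ w)) u = β (pd i φ u) (ψ u) + β (φ u) (pd i ψ u) := by
  have h := β.hasFDerivAt_of_bilinear hφ.hasFDerivAt hψ.hasFDerivAt
  simp [pd, h.fderiv, add_comm]

theorem pd_smul {c : Plane → ℝ} {φ : Plane → F} (hc : DifferentiableAt ℝ c u)
    (hφ : DifferentiableAt ℝ φ u) :
    pd i (fun w => c w • φ w) u = pd i c u • φ u + c u • pd i φ u :=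
  pd_bilin (ContinuousLinearMap.lsmul ℝ ℝ) hc hφ

theorem pd_mul {c d : Plane → ℝ} (hc : DifferentiableAt ℝ c u) (hd : DifferentiableAt ℝ d u) :
    pd i (fun w => c w * d w) u = pd i c u * d u + c u * pd i d u :=
  pd_smul hc hd

theorem pd_lor {φ ψ : Plane → Mink} (hφ : DifferentiableAt ℝ φ u)
    (hψ : DifferentiableAt ℝ ψ u) :
    pd i (fun w => lor (φ w) (ψ w)) u = lor (pd i φ u) (ψ u) + lor (φ u) (pd i ψ u) :=
  pd_bilin lorL hφ hψ

theorem ContDiffAt.bilin (β : E →L[ℝ] F →L[ℝ] G) {φ : Plane → E} {ψ : Plane → F}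
    (hφ : ContDiffAt ℝ ∞ φ u) (hψ : ContDiffAt ℝ ∞ ψ u) :
    ContDiffAt ℝ ∞ (fun w => β (φ w) (ψ w)) u :=
  (β.contDiff.contDiffAt.comp u hφ).clm_apply hψ

theorem ContDiffAt.lor {φ ψ : Plane → Mink} (hφ : ContDiffAt ℝ ∞ φ u)
    (hψ : ContDiffAt ℝ ∞ ψ u) : ContDiffAt ℝ ∞ (fun w => lor (φ w) (ψ w)) u :=
  hφ.bilin lorL hψ

theorem ContDiffAt.pd {φ : Plane → F} (hφ : ContDiffAt ℝ ∞ φ u) (i : Fin 2) :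
    ContDiffAt ℝ ∞ (pd i φ) u :=
  (hφ.fderiv_right (m := ∞) (by simp)).clm_apply contDiffAt_const

theorem ContDiffAt.differentiableAt_top {φ : Plane → F} (hφ : ContDiffAt ℝ ∞ φ u) :
    DifferentiableAt ℝ φ u :=
  hφ.differentiableAt (by simp)

theorem pd_pd {φ : Plane → F} (hφ : ContDiffAt ℝ ∞ φ u) :
    pd i (pd j φ) u =
      fderiv ℝ (fderiv ℝ φ) u (EuclideanSpace.single i 1) (EuclideanSpace.single j 1) := by
  have h : DifferentiableAt ℝ (fderiv ℝ φ) u :=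
    (hφ.fderiv_right (m := ∞) (by simp)).differentiableAt_top
  rw [pd, show pd j φ = fun w => fderiv ℝ φ w (EuclideanSpace.single j 1) from rfl,
    fderiv_clm_apply h (differentiableAt_const _)]
  simp

theorem pd_comm {φ : Plane → F} (hφ : ContDiffAt ℝ ∞ φ u) (i j : Fin 2) :
    pd i (pd j φ) u = pd j (pd i φ) u := by
  rw [pd_pd hφ, pd_pd hφ]
  exact hφ.isSymmSndFDerivAt (by simpa using WithTop.coe_le_coe.2 (le_top (a := (2 : ℕ∞)))) _ _

theorem fderiv_eq_sum_pd (φ : Plane → F) (u v : Plane) :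
    fderiv ℝ φ u v = ∑ k, v k • pd k φ u := by
  have h : v = ∑ k, v k • (EuclideanSpace.single k 1 : Plane) := by
    ext l
    fin_cases l <;> simp
  conv_lhs => rw [h]
  simp only [map_sum, map_smul]
  rfl

end PartialDerivatives


/-! ### Local theory of space-like surfaces -/

theorem metric_apply (X : Plane → Mink) (u : Plane) (i j : Fin 2) :
    metric X u i j = lor (pd i X u) (pd j X u) := rfl

theorem metric_transpose (X : Plane → Mink) (u : Plane) : (metric X u).transpose = metric X u := by
  ext i j
  exact lor_comm _ _

theorem metric_comm (X : Plane → Mink) (u : Plane) (i j : Fin 2) :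
    metric X u i j = metric X u j i := lor_comm _ _

theorem metric_inv_comm (X : Plane → Mink) (u : Plane) (i j : Fin 2) :
    (metric X u)⁻¹ i j = (metric X u)⁻¹ j i := by
  conv_lhs => rw [← metric_transpose, ← Matrix.transpose_nonsing_inv, Matrix.transpose_apply]

/-- The linear map underlying `normalPart`. -/
def normalPartL (X : Plane → Mink) (u : Plane) : Mink →ₗ[ℝ] Mink where
  toFun := normalPart X u
  map_add' v w := by
    simp only [normalPart, lor_add_left, mul_add, add_smul, Finset.sum_add_distrib]
    abel
  map_smul' c v := by
    simp only [normalPart, lor_smul_left, RingHom.id_apply, smul_sub, Finset.smul_sum, smul_smul]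
    simp only [mul_left_comm c]

section normalPartLinear

variable (X : Plane → Mink) (u : Plane)

theorem normalPart_add (v w : Mink) :
    normalPart X u (v + w) = normalPart X u v + normalPart X u w := map_add (normalPartL X u) v w

theorem normalPart_sub (v w : Mink) :
    normalPart X u (v - w) = normalPart X u v - normalPart X u w := map_sub (normalPartL X u) v w

theorem normalPart_neg (v : Mink) : normalPart X u (-v) = -normalPart X u v :=
  map_neg (normalPartL X u) v

theorem normalPart_smul (c : ℝ) (v : Mink) :
    normalPart X u (c • v) = c • normalPart X u v := map_smul (normalPartL X u) c v

theorem normalPart_sum {ι : Type*} (s : Finset ι) (f : ι → Mink) :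
    normalPart X u (∑ i ∈ s, f i) = ∑ i ∈ s, normalPart X u (f i) :=
  map_sum (normalPartL X u) f s

end normalPartLinear

/-- `X` parametrizes, over the open set `V`, a smooth space-like surface in de Sitter space. -/
structure IsSpacelikeOn (X : Plane → Mink) (V : Set Plane) : Prop where
  isOpen : IsOpen V
  smooth : ∀ u ∈ V, ContDiffAt ℝ ∞ X u
  sphere : ∀ u ∈ V, lor (X u) (X u) = 1
  det_pos : ∀ u ∈ V, 0 < (metric X u).det

theorem pd_comp_real {f : ℝ → ℝ} {f' : ℝ} {c : Plane → ℝ} {u : Plane} {i : Fin 2}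
    (hf : HasDerivAt f f' (c u)) (hc : DifferentiableAt ℝ c u) :
    pd i (fun w => f (c w)) u = f' * pd i c u := by
  have h := (hf.hasFDerivAt.comp u hc.hasFDerivAt).fderiv
  rw [pd, show (fun w => f (c w)) = f ∘ c from rfl, h]
  simp [pd, mul_comm]

theorem contDiffAt_det_metric {X : Plane → Mink} {u : Plane} (h : ContDiffAt ℝ ∞ X u) :
    ContDiffAt ℝ ∞ (fun w => (metric X w).det) u := by
  have hg : ∀ i j, ContDiffAt ℝ ∞ (fun w => metric X w i j) u := fun i j => (h.pd i).lor (h.pd j)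
  simp only [Matrix.det_fin_two]
  exact ((hg _ _).mul (hg _ _)).sub ((hg _ _).mul (hg _ _))

namespace IsSpacelikeOn

variable {X : Plane → Mink} {V : Set Plane} (hX : IsSpacelikeOn X V) {u : Plane} (hu : u ∈ V)

include hX hu


theorem eventually {P : Plane → Prop} (h : ∀ w ∈ V, P w) : ∀ᶠ w in 𝓝 u, P w :=
  Filter.eventually_of_mem (hX.isOpen.mem_nhds hu) h

theorem diff : DifferentiableAt ℝ X u := (hX.smooth u hu).differentiableAt_top

theorem isUnit_det : IsUnit (metric X u).det := (hX.det_pos u hu).ne'.isUnit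

theorem inv_mul_metric : (metric X u)⁻¹ * metric X u = 1 :=
  Matrix.nonsing_inv_mul _ (hX.isUnit_det hu)

theorem metric_mul_inv : metric X u * (metric X u)⁻¹ = 1 :=
  Matrix.mul_nonsing_inv _ (hX.isUnit_det hu)

theorem sum_inv_metric (i j : Fin 2) :
    ∑ k, (metric X u)⁻¹ i k * metric X u k j = if i = j then 1 else 0 := by
  rw [← Matrix.mul_apply, hX.inv_mul_metric hu, Matrix.one_apply]

theorem lor_pd (i : Fin 2) : lor (X u) (pd i X u) = 0 := by
  have h : (fun w => lor (X w) (X w)) =ᶠ[𝓝 u] fun _ => 1 := hX.eventually hu hX.sphere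
  have h2 := pd_congr (i := i) h
  rw [pd_const, pd_lor (hX.diff hu) (hX.diff hu), lor_comm (pd i X u)] at h2
  linarith

theorem contDiffAt_pd (i : Fin 2) : ContDiffAt ℝ ∞ (pd i X) u := (hX.smooth u hu).pd i

theorem lor_pd_pd (i j : Fin 2) : lor (pd i (pd j X) u) (X u) = -metric X u i j := by
  have h : (fun w => lor (pd j X w) (X w)) =ᶠ[𝓝 u] fun _ => 0 :=
    hX.eventually hu fun w hw => (lor_comm _ _).trans (hX.lor_pd hw j)
  have h2 := pd_congr (i := i) h
  rw [pd_const, pd_lor (hX.contDiffAt_pd hu j).differentiableAt_top (hX.diff hu)] at h2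
  rw [metric_comm, metric_apply]
  linarith

theorem contDiffAt_metric (i j : Fin 2) : ContDiffAt ℝ ∞ (fun w => metric X w i j) u :=
  (hX.contDiffAt_pd hu i).lor (hX.contDiffAt_pd hu j)

theorem contDiffAt_det : ContDiffAt ℝ ∞ (fun w => (metric X w).det) u :=
  contDiffAt_det_metric (hX.smooth u hu)

theorem contDiffAt_inv (i j : Fin 2) : ContDiffAt ℝ ∞ (fun w => (metric X w)⁻¹ i j) u := by
  have h := (hX.contDiffAt_det hu).inv (hX.det_pos u hu).ne'
  simp only [Matrix.inv_def, Ring.inverse_eq_inv', Matrix.adjugate_fin_two, Matrix.smul_apply,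
    smul_eq_mul]
  refine h.mul ?_
  fin_cases i <;> fin_cases j <;>
    simpa using by first
      | exact hX.contDiffAt_metric hu _ _
      | exact (hX.contDiffAt_metric hu _ _).neg

theorem pd_metric (k i j : Fin 2) :
    pd k (fun w => metric X w i j) u =
      lor (pd k (pd i X) u) (pd j X u) + lor (pd i X u) (pd k (pd j X) u) :=
  pd_lor (hX.contDiffAt_pd hu i).differentiableAt_top (hX.contDiffAt_pd hu j).differentiableAt_top

/-- In the Koszul formula the product rule gives six terms; by symmetry of second derivatives four
cancel and two agree. -/
theorem christoffel_eq (k i j : Fin 2) :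
    christoffel X k i j u = ∑ l, (metric X u)⁻¹ k l * lor (pd i (pd j X) u) (pd l X u) := by
  rw [christoffel, Finset.mul_sum]
  refine Finset.sum_congr rfl fun l _ => ?_
  rw [hX.pd_metric hu, hX.pd_metric hu, hX.pd_metric hu, pd_comm (hX.smooth u hu) l i,
    pd_comm (hX.smooth u hu) l j, pd_comm (hX.smooth u hu) j i,
    lor_comm (pd j X u), lor_comm (pd i X u)]
  ring

theorem christoffel_comm (k i j : Fin 2) : christoffel X k i j u = christoffel X k j i u := by
  rw [hX.christoffel_eq hu, hX.christoffel_eq hu, pd_comm (hX.smooth u hu)]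

theorem sum_christoffel_metric (i j k : Fin 2) :
    ∑ l, christoffel X l i j u * metric X u l k = lor (pd i (pd j X) u) (pd k X u) := by
  have h1 := hX.sum_inv_metric hu 0 k
  have h2 := hX.sum_inv_metric hu 1 k
  simp only [hX.christoffel_eq hu, Fin.sum_univ_two, metric_inv_comm X u 1 0] at *
  fin_cases k <;> simp at * <;>
    linear_combination lor (pd i (pd j X) u) (pd 0 X u) * h1 +
      lor (pd i (pd j X) u) (pd 1 X u) * h2

theorem pd_metric_eq (k i j : Fin 2) :
    pd k (fun w => metric X w i j) u =
      ∑ l, (christoffel X l k i u * metric X u l j + christoffel X l k j u * metric X u i l) := by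
  simp only [Finset.sum_add_distrib, metric_comm X u i]
  rw [hX.pd_metric hu, hX.sum_christoffel_metric hu, hX.sum_christoffel_metric hu,
    lor_comm (pd i X u)]

theorem contDiffAt_christoffel (k i j : Fin 2) : ContDiffAt ℝ ∞ (christoffel X k i j) u := by
  unfold christoffel
  refine contDiffAt_const.mul (ContDiffAt.sum fun l _ => (hX.contDiffAt_inv hu k l).mul ?_)
  exact (((hX.contDiffAt_metric hu _ _).pd _).add ((hX.contDiffAt_metric hu _ _).pd _)).sub
    ((hX.contDiffAt_metric hu _ _).pd _)

/-- The inverse metric is parallel for the Levi-Civita connection. -/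
theorem pd_inv_metric (k i j : Fin 2) :
    pd k (fun w => (metric X w)⁻¹ i j) u =
      -∑ l, (christoffel X i k l u * (metric X u)⁻¹ l j +
        christoffel X j k l u * (metric X u)⁻¹ i l) := by
  set g := metric X u with hg
  let dG : Matrix (Fin 2) (Fin 2) ℝ := .of fun a b => pd k (fun w => (metric X w)⁻¹ a b) u
  let P : Matrix (Fin 2) (Fin 2) ℝ := .of fun l a => christoffel X l k a u
  -- The derivative of g⁻¹ g = 1, with ∂ₖg expressed through the Christoffel symbols; multiplying by
  -- g⁻¹ on the right isolates ∂ₖ(g⁻¹).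
  have h1 : dG * g + g⁻¹ * (P.transpose * g + g * P) = 0 := by
    ext a c
    have h : (fun w => ∑ b, (metric X w)⁻¹ a b * metric X w b c) =ᶠ[𝓝 u]
        fun _ => if a = c then 1 else 0 :=
      hX.eventually hu fun w hw => hX.sum_inv_metric hw a c
    have h2 := pd_congr (i := k) h
    rw [pd_const, pd_sum fun b _ => ((hX.contDiffAt_inv hu a b).mul
      (hX.contDiffAt_metric hu b c)).differentiableAt_top] at h2
    simp only [pd_mul (hX.contDiffAt_inv hu a _).differentiableAt_top
      (hX.contDiffAt_metric hu _ c).differentiableAt_top, hX.pd_metric_eq hu,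
      Fin.sum_univ_two] at h2
    simp only [Matrix.add_apply, Matrix.mul_apply, Fin.sum_univ_two, Matrix.zero_apply, dG, P,
      Matrix.of_apply, Matrix.transpose_apply]
    rw [← h2]
    ring
  have hgi : g⁻¹ * g = 1 := hX.inv_mul_metric hu
  have hig : g * g⁻¹ = 1 := hX.metric_mul_inv hu
  have h3 : dG = -(g⁻¹ * P.transpose + P * g⁻¹) := by
    calc dG = (dG * g + g⁻¹ * (P.transpose * g + g * P)) * g⁻¹
          - (g⁻¹ * P.transpose * (g * g⁻¹) + (g⁻¹ * g) * P * g⁻¹)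
          + dG * (1 - g * g⁻¹) := by noncomm_ring
      _ = _ := by rw [h1, hgi, hig]; noncomm_ring
  have h4 := congrFun (congrFun h3 i) j
  simp only [Matrix.neg_apply, Matrix.add_apply, Matrix.mul_apply, Fin.sum_univ_two, dG, P,
    Matrix.of_apply, Matrix.transpose_apply] at h4
  rw [h4]
  simp only [Fin.sum_univ_two]
  ring

theorem pd_det (k : Fin 2) :
    pd k (fun w => (metric X w).det) u =
      2 * (metric X u).det * ∑ l, christoffel X l k l u := by
  have d := fun i j => (hX.contDiffAt_metric hu i j).differentiableAt_top
  simp only [Matrix.det_fin_two]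
  rw [pd_sub ((d _ _).fun_mul (d _ _)) ((d _ _).fun_mul (d _ _)), pd_mul (d _ _) (d _ _),
    pd_mul (d _ _) (d _ _)]
  simp only [hX.pd_metric_eq hu, Fin.sum_univ_two]
  ring

theorem contDiffAt_inv_sqrt_det :
    ContDiffAt ℝ ∞ (fun w => (√(metric X w).det)⁻¹) u :=
  ((hX.contDiffAt_det hu).sqrt (hX.det_pos u hu).ne').inv (Real.sqrt_ne_zero'.2 (hX.det_pos u hu))

theorem pd_inv_sqrt_det (k : Fin 2) :
    pd k (fun w => (√(metric X w).det)⁻¹) u =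
      -((√(metric X u).det)⁻¹ * ∑ l, christoffel X l k l u) := by
  have hd := hX.det_pos u hu
  have hs : √(metric X u).det ≠ 0 := Real.sqrt_ne_zero'.2 hd
  have h := pd_comp_real (i := k) (c := fun w => (metric X w).det)
    ((Real.hasDerivAt_sqrt hd.ne').inv hs) (hX.contDiffAt_det hu).differentiableAt_top
  refine Eq.trans h ?_
  rw [hX.pd_det hu]
  have h2 : (metric X u).det = √(metric X u).det ^ 2 := (Real.sq_sqrt hd.le).symm
  generalize √(metric X u).det = s at *
  rw [h2]
  field_simp

/-- The Gauss formula: the position component is -gᵢⱼ because X is orthogonal to its derivatives,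
and the tangential one is given by `christoffel_eq`. -/
theorem pd_pd_eq (i j : Fin 2) :
    pd i (pd j X) u = secondForm X i j u - metric X u i j • X u +
      ∑ l, christoffel X l i j u • pd l X u := by
  simp only [secondForm, normalPart, hX.lor_pd_pd hu, hX.christoffel_eq hu, Finset.sum_smul]
  module

theorem lor_normalPart_self (w : Mink) : lor (normalPart X u w) (X u) = 0 := by
  have h := fun k => (lor_comm (pd k X u) (X u)).trans (hX.lor_pd hu k)
  simp [normalPart, hX.sphere u hu, h]

theorem lor_normalPart_pd (w : Mink) (k : Fin 2) :
    lor (normalPart X u w) (pd k X u) = 0 := by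
  simp only [normalPart, lor_sub_left, lor_smul_left, lor_sum_left, hX.lor_pd hu, ← metric_apply]
  have h0 := hX.sum_inv_metric hu 0 k
  have h1 := hX.sum_inv_metric hu 1 k
  simp only [Fin.sum_univ_two, metric_inv_comm X u 1 0] at *
  fin_cases k <;> simp at * <;>
    linear_combination - lor w (pd 0 X u) * h0 - lor w (pd 1 X u) * h1

theorem normalPart_self : normalPart X u (X u) = 0 := by
  simp [normalPart, hX.sphere u hu, hX.lor_pd hu]

theorem normalPart_pd (k : Fin 2) : normalPart X u (pd k X u) = 0 := by
  have h0 := hX.sum_inv_metric hu 0 k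
  have h1 := hX.sum_inv_metric hu 1 k
  simp only [normalPart, ← metric_apply, lor_comm _ (X u), hX.lor_pd hu, ← Finset.sum_smul]
  simp only [metric_comm X u k, Fin.sum_univ_two (M := Mink), h0, h1]
  fin_cases k <;> simp


omit hX hu in
theorem normalPart_of_orthogonal {w : Mink} (h : lor w (X u) = 0)
    (h' : ∀ k, lor w (pd k X u) = 0) : normalPart X u w = w := by
  simp [normalPart, h, h']

omit hX hu in
theorem lor_normalPart_of_orthogonal {v : Mink} (h : lor v (X u) = 0)
    (h' : ∀ k, lor v (pd k X u) = 0) (w : Mink) : lor v (normalPart X u w) = lor v w := by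
  simp [normalPart, h, h']

theorem normalPart_normalPart (w : Mink) :
    normalPart X u (normalPart X u w) = normalPart X u w :=
  normalPart_of_orthogonal (hX.lor_normalPart_self hu w) (hX.lor_normalPart_pd hu w)

theorem secondForm_comm (i j : Fin 2) : secondForm X i j u = secondForm X j i u := by
  rw [secondForm, secondForm, pd_comm (hX.smooth u hu)]

theorem lor_secondForm_self (i j : Fin 2) : lor (secondForm X i j u) (X u) = 0 :=
  hX.lor_normalPart_self hu _

theorem lor_secondForm_pd (i j k : Fin 2) : lor (secondForm X i j u) (pd k X u) = 0 :=
  hX.lor_normalPart_pd hu _ k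

theorem normalPart_secondForm (i j : Fin 2) :
    normalPart X u (secondForm X i j u) = secondForm X i j u :=
  hX.normalPart_normalPart hu _

theorem contDiffAt_normalPart {Y : Plane → Mink} (hY : ContDiffAt ℝ ∞ Y u) :
    ContDiffAt ℝ ∞ (fun w => normalPart X w (Y w)) u := by
  have hs := hX.smooth u hu
  refine (hY.sub ((hY.lor hs).smul hs)).sub (ContDiffAt.sum fun i _ => ContDiffAt.sum fun j _ => ?_)
  exact ((hX.contDiffAt_inv hu i j).mul (hY.lor (hs.pd j))).smul (hs.pd i)

theorem contDiffAt_secondForm (i j : Fin 2) : ContDiffAt ℝ ∞ (secondForm X i j) u :=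
  hX.contDiffAt_normalPart hu (((hX.smooth u hu).pd j).pd i)

omit hX hu in
theorem normalPart_pd_pd (i j : Fin 2) :
    normalPart X u (pd i (pd j X) u) = secondForm X i j u := rfl

theorem lor_secondForm_pd_pd (i j k l : Fin 2) :
    lor (secondForm X i j u) (pd k (pd l X) u) =
      lor (secondForm X i j u) (secondForm X k l u) := by
  rw [hX.pd_pd_eq hu k l]
  simp [hX.lor_secondForm_self hu, hX.lor_secondForm_pd hu]

/-- The normal part of a derivative of the second fundamental form. -/
theorem normalPart_pd_secondForm (i j k : Fin 2) :
    normalPart X u (pd i (secondForm X j k) u) =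
      normalPart X u (pd i (pd j (pd k X)) u) -
        ∑ l, christoffel X l j k u • secondForm X i l u := by
  have hs := hX.smooth u hu
  have h : secondForm X j k =ᶠ[𝓝 u] fun w => pd j (pd k X) w + metric X w j k • X w -
      ∑ l, christoffel X l j k w • pd l X w :=
    hX.eventually hu fun w hw => by
      beta_reduce; rw [hX.pd_pd_eq hw]; module
  have d1 := ((hs.pd k).pd j).differentiableAt_top
  have d2 : DifferentiableAt ℝ (fun w => metric X w j k • X w) u :=
    ((hX.contDiffAt_metric hu j k).smul hs).differentiableAt_top
  have d3 : ∀ l, DifferentiableAt ℝ (fun w => christoffel X l j k w • pd l X w) u :=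
    fun l => ((hX.contDiffAt_christoffel hu l j k).smul (hs.pd l)).differentiableAt_top
  rw [pd_congr h, pd_sub (d1.fun_add d2) (DifferentiableAt.fun_sum fun l _ => d3 l), pd_add d1 d2,
    pd_sum fun l _ => d3 l, pd_smul (hX.contDiffAt_metric hu j k).differentiableAt_top (hX.diff hu)]
  simp only [pd_smul (hX.contDiffAt_christoffel hu _ j k).differentiableAt_top
    (hs.pd _).differentiableAt_top]
  simp [normalPart_add, normalPart_sub, normalPart_smul, hX.normalPart_self hu,
    hX.normalPart_pd hu, normalPart_pd_pd]

/-- The Weingarten formula for a derivative of the second fundamental form. -/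
theorem pd_secondForm (i j k : Fin 2) :
    pd i (secondForm X j k) u = normalPart X u (pd i (secondForm X j k) u) -
      ∑ m, ∑ l, ((metric X u)⁻¹ m l * lor (secondForm X j k u) (secondForm X i l u)) •
        pd m X u := by
  have hs := hX.smooth u hu
  have dh := (hX.contDiffAt_secondForm hu j k).differentiableAt_top
  have h1 : lor (pd i (secondForm X j k) u) (X u) = 0 := by
    have h : (fun w => lor (secondForm X j k w) (X w)) =ᶠ[𝓝 u] fun _ => 0 :=
      hX.eventually hu fun w hw => hX.lor_secondForm_self hw j k
    have h2 := pd_congr (i := i) h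
    rwa [pd_const, pd_lor dh (hX.diff hu), hX.lor_secondForm_pd hu, add_zero] at h2
  have h2 : ∀ l, lor (pd i (secondForm X j k) u) (pd l X u) =
      -lor (secondForm X j k u) (secondForm X i l u) := fun l => by
    have h : (fun w => lor (secondForm X j k w) (pd l X w)) =ᶠ[𝓝 u] fun _ => 0 :=
      hX.eventually hu fun w hw => hX.lor_secondForm_pd hw j k l
    have h2 := pd_congr (i := i) h
    rw [pd_const, pd_lor dh (hs.pd l).differentiableAt_top, hX.lor_secondForm_pd_pd hu] at h2
    linarith
  simp only [normalPart, h1, h2, Fin.sum_univ_two]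
  module

end IsSpacelikeOn


/-! ### The Laplacian of the Gauss map -/

/-- The second fundamental form `h(∂ᵢ, ∂ⱼ) - gᵢⱼ X` of the surface in Minkowski space. -/
def ambientForm (X : Plane → Mink) (i j : Fin 2) (u : Plane) : Mink :=
  secondForm X i j u - metric X u i j • X u

/-- The component of `∂ᵢ∂ⱼ∂ₖX` orthogonal to the surface in Minkowski space. -/
def ambientCubic (X : Plane → Mink) (i j k : Fin 2) (u : Plane) : Mink :=
  normalPart X u (pd i (pd j (pd k X)) u) -
    (∑ l, (christoffel X l i j u * metric X u l k + christoffel X l i k u * metric X u j l +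
      christoffel X l j k u * metric X u i l)) • X u

/-- The mean curvature vector `(1/2) gⁱʲ hᵢⱼ` of a parametrized surface. -/
def meanVector (X : Plane → Mink) (u : Plane) : Mink :=
  (1 / 2 : ℝ) • ∑ i, ∑ j, (metric X u)⁻¹ i j • secondForm X i j u

/-- The squared norm `gⁱʲ gᵏˡ ⟨hᵢₖ, hⱼₗ⟩` of the second fundamental form. -/
def formNormSq (X : Plane → Mink) (u : Plane) : ℝ :=
  ∑ i, ∑ j, ∑ k, ∑ l, (metric X u)⁻¹ i j * (metric X u)⁻¹ k l *
    lor (secondForm X i k u) (secondForm X j l u)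

/-- The contraction of the Gauss map with a bilinear form. -/
def gaussForm (X : Plane → Mink) (η : Mink →L[ℝ] Mink →L[ℝ] ℝ) (u : Plane) : ℝ :=
  (√(metric X u).det)⁻¹ * η (pd 0 X u) (pd 1 X u)

theorem apply_swap_of_alternating {η : Mink →L[ℝ] Mink →L[ℝ] ℝ} (hη : ∀ v, η v v = 0)
    (v w : Mink) : η v w = -η w v := by
  have := hη (v + w)
  simp [hη] at this
  linarith

/-- The pointwise algebra behind the Laplacian of the Gauss map: `T` are the tangent vectors, `B`
the second fundamental form, `F` the normal components of the third derivatives. -/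
theorem laplace_algebra {η : Mink →L[ℝ] Mink →L[ℝ] ℝ} (hη : ∀ v, η v v = 0)
    (T : Fin 2 → Mink) (B : Fin 2 → Fin 2 → Mink) (F : Fin 2 → Fin 2 → Fin 2 → Mink)
    (Γ : Fin 2 → Fin 2 → Fin 2 → ℝ) (G : Fin 2 → Fin 2 → ℝ)
    (S : Fin 2 → Fin 2 → Fin 2 → Fin 2 → ℝ) (s : ℝ)
    (hB : B 1 0 = B 0 1) (hF : ∀ i, F i 1 0 = F i 0 1) (hF' : ∀ i, F 1 0 i = F 0 1 i)
    (hΓ : ∀ k, Γ k 1 0 = Γ k 0 1) (hG : G 1 0 = G 0 1) :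
    -∑ i, ∑ j, G i j * ((
      -(s * ∑ l, Γ l i l) * (η (B j 0) (T 1) + η (T 0) (B j 1)) +
      s * (η (F i j 0 - ∑ l, Γ l j 0 • B i l - ∑ m, ∑ l, (G m l * S j 0 i l) • T m) (T 1) +
        η (B j 0) (B i 1 + ∑ l, Γ l i 1 • T l) + (η (B i 0 + ∑ l, Γ l i 0 • T l) (B j 1) +
        η (T 0) (F i j 1 - ∑ l, Γ l j 1 • B i l - ∑ m, ∑ l, (G m l * S j 1 i l) • T m)))) -
      ∑ k, Γ k i j * (s * (η (B k 0) (T 1) + η (T 0) (B k 1)))) =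
    (∑ i, ∑ j, ∑ k, ∑ l, G i j * G k l * S j k i l) * (s * η (T 0) (T 1)) -
      s * (η (∑ i, ∑ j, G i j • (F i j 0 - ∑ l, Γ l i j • B l 0 - ∑ l, (2 * Γ l i 0) • B j l)) (T 1)
        + η (T 0) (∑ i, ∑ j, G i j • (F i j 1 - ∑ l, Γ l i j • B l 1 - ∑ l, (2 * Γ l i 1) • B j l))
        + 2 * ∑ i, ∑ j, G i j * η (B i 0) (B j 1)) := by
  have h2 := fun k i j => apply_swap_of_alternating hη (T k) (B i j)
  have h3 := fun k i j l => apply_swap_of_alternating hη (T k) (F i j l)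
  simp only [Fin.sum_univ_two, map_add, map_sub, map_smul, add_apply,
    sub_apply, smul_apply, smul_eq_mul, h2, h3, hη, hB,
    hF, hF', hΓ, hG]
  ring

namespace IsSpacelikeOn

variable {X : Plane → Mink} {V : Set Plane} (hX : IsSpacelikeOn X V) {u : Plane} (hu : u ∈ V)

include hX hu

theorem ambientForm_comm (i j : Fin 2) : ambientForm X i j u = ambientForm X j i u := by
  rw [ambientForm, ambientForm, hX.secondForm_comm hu, metric_comm]

theorem contDiffAt_ambientForm (i j : Fin 2) : ContDiffAt ℝ ∞ (ambientForm X i j) u :=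
  (hX.contDiffAt_secondForm hu i j).sub ((hX.contDiffAt_metric hu i j).smul (hX.smooth u hu))

theorem pd_pd_eq_ambient (i j : Fin 2) :
    pd i (pd j X) u = ambientForm X i j u + ∑ l, christoffel X l i j u • pd l X u :=
  hX.pd_pd_eq hu i j

/-- With `ambientCubic_comm_right` this gives total symmetry, which plays the role of the Codazzi
equation: both reflect commuting partial derivatives of X. -/
theorem ambientCubic_comm_left (i j k : Fin 2) :
    ambientCubic X i j k u = ambientCubic X j i k u := by
  simp only [ambientCubic, pd_comm (hX.contDiffAt_pd hu k) i j, hX.christoffel_comm hu _ i j,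
    metric_comm X u j]
  congr 2
  exact Finset.sum_congr rfl fun l _ => by rw [metric_comm X u i]; ring

theorem ambientCubic_comm_right (i j k : Fin 2) :
    ambientCubic X i j k u = ambientCubic X i k j u := by
  have h : pd j (pd k X) =ᶠ[𝓝 u] pd k (pd j X) :=
    hX.eventually hu fun w hw => pd_comm (hX.smooth w hw) j k
  simp only [ambientCubic, pd_congr h, hX.christoffel_comm hu _ j k]
  congr 2
  exact Finset.sum_congr rfl fun l _ => by rw [metric_comm X u k, metric_comm X u j]; ring

theorem lor_ambientForm (i j k l : Fin 2) :
    lor (ambientForm X i j u) (ambientForm X k l u) =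
      lor (secondForm X i j u) (secondForm X k l u) + metric X u i j * metric X u k l := by
  have h := fun i j => (lor_comm (X u) _).trans (hX.lor_secondForm_self hu i j)
  simp [ambientForm, h, hX.lor_secondForm_self hu, hX.sphere u hu, mul_comm]

/-- The Weingarten formula in Minkowski space. Differentiating -gⱼₖ X produces the tangential term
-gⱼₖ ∂ᵢX, which is the position vector's share of the shape operator (`h2`). -/
theorem pd_ambientForm (i j k : Fin 2) :
    pd i (ambientForm X j k) u = ambientCubic X i j k u -
      ∑ l, christoffel X l j k u • ambientForm X i l u -
      ∑ m, ∑ l, ((metric X u)⁻¹ m l * lor (ambientForm X j k u) (ambientForm X i l u)) •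
        pd m X u := by
  have h : pd i (ambientForm X j k) u = pd i (secondForm X j k) u -
      (pd i (fun w => metric X w j k) u • X u + metric X u j k • pd i X u) := by
    rw [← pd_smul (hX.contDiffAt_metric hu j k).differentiableAt_top (hX.diff hu)]
    exact pd_sub (hX.contDiffAt_secondForm hu j k).differentiableAt_top
      ((hX.contDiffAt_metric hu j k).smul (hX.smooth u hu)).differentiableAt_top
  have h2 : ∑ m, ∑ l, ((metric X u)⁻¹ m l * (metric X u j k * metric X u i l)) • pd m X u =
      metric X u j k • pd i X u := by
    have h0 := hX.sum_inv_metric hu 0 i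
    have h1 := hX.sum_inv_metric hu 1 i
    simp only [Fin.sum_univ_two] at *
    have e : ∀ m, (metric X u)⁻¹ m 0 * (metric X u j k * metric X u i 0) +
        (metric X u)⁻¹ m 1 * (metric X u j k * metric X u i 1) = metric X u j k *
        ((metric X u)⁻¹ m 0 * metric X u 0 i + (metric X u)⁻¹ m 1 * metric X u 1 i) := fun m => by
      rw [metric_comm X u i 0, metric_comm X u i 1]; ring
    rw [← add_smul, ← add_smul, e, e, h0, h1]
    fin_cases i <;> simp
  rw [h, hX.pd_secondForm hu, hX.normalPart_pd_secondForm hu, hX.pd_metric_eq hu]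
  simp only [hX.lor_ambientForm hu, mul_add, add_smul, Finset.sum_add_distrib, h2]
  simp only [ambientCubic, ambientForm, add_smul, Finset.sum_add_distrib]
  simp only [smul_sub, Finset.sum_sub_distrib, smul_smul, ← Finset.sum_smul]
  module

/-- The derivative of (det g)^(-1/2) cancels the tangential parts of ∂ⱼ∂₀X and ∂ⱼ∂₁X, so only the
second fundamental form remains. -/
theorem pd_gaussForm {η : Mink →L[ℝ] Mink →L[ℝ] ℝ} (hη : ∀ v, η v v = 0) (j : Fin 2) :
    pd j (gaussForm X η) u = (√(metric X u).det)⁻¹ *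
      (η (ambientForm X j 0 u) (pd 1 X u) + η (pd 0 X u) (ambientForm X j 1 u)) := by
  have hT := fun i => hX.contDiffAt_pd hu i
  refine (pd_mul (hX.contDiffAt_inv_sqrt_det hu).differentiableAt_top
    ((hT 0).bilin η (hT 1)).differentiableAt_top).trans ?_
  rw [hX.pd_inv_sqrt_det hu, pd_bilin η (hT 0).differentiableAt_top (hT 1).differentiableAt_top,
    hX.pd_pd_eq_ambient hu, hX.pd_pd_eq_ambient hu]
  simp only [Fin.sum_univ_two, map_add, map_smul, add_apply,
    smul_apply, smul_eq_mul, hη]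
  rw [hX.christoffel_comm hu 0 j 0, hX.christoffel_comm hu 1 j 1]
  ring

theorem pd_pd_gaussForm {η : Mink →L[ℝ] Mink →L[ℝ] ℝ} (hη : ∀ v, η v v = 0) (i j : Fin 2) :
    pd i (pd j (gaussForm X η)) u =
      -((√(metric X u).det)⁻¹ * ∑ l, christoffel X l i l u) *
        (η (ambientForm X j 0 u) (pd 1 X u) + η (pd 0 X u) (ambientForm X j 1 u)) +
      (√(metric X u).det)⁻¹ *
        (η (pd i (ambientForm X j 0) u) (pd 1 X u) + η (ambientForm X j 0 u) (pd i (pd 1 X) u) +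
        (η (pd i (pd 0 X) u) (ambientForm X j 1 u) +
          η (pd 0 X u) (pd i (ambientForm X j 1) u))) := by
  have h : pd j (gaussForm X η) =ᶠ[𝓝 u] fun w => (√(metric X w).det)⁻¹ *
      (η (ambientForm X j 0 w) (pd 1 X w) + η (pd 0 X w) (ambientForm X j 1 w)) :=
    hX.eventually hu fun w hw => hX.pd_gaussForm hw hη j
  have hT := fun i => hX.contDiffAt_pd hu i
  have hB := fun i => hX.contDiffAt_ambientForm hu j i
  have d1 := (hB 0).bilin η (hT 1)
  have d2 := (hT 0).bilin η (hB 1)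
  rw [pd_congr h, pd_mul (hX.contDiffAt_inv_sqrt_det hu).differentiableAt_top
    (d1.add d2).differentiableAt_top, hX.pd_inv_sqrt_det hu,
    pd_add d1.differentiableAt_top d2.differentiableAt_top,
    pd_bilin η (hB 0).differentiableAt_top (hT 1).differentiableAt_top,
    pd_bilin η (hT 0).differentiableAt_top (hB 1).differentiableAt_top]

/-- The traced Codazzi equation: it recognizes as DH the third-order terms that `laplace_algebra`
leaves in the Laplacian. -/
theorem normalPart_pd_meanVector (k : Fin 2) :
    (2 : ℝ) • normalPart X u (pd k (meanVector X) u) =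
      ∑ i, ∑ j, (metric X u)⁻¹ i j • (ambientCubic X i j k u -
        ∑ l, christoffel X l i j u • ambientForm X l k u -
        ∑ l, (2 * christoffel X l i k u) • ambientForm X j l u) := by
  have hG := fun i j => (hX.contDiffAt_inv hu i j).differentiableAt_top
  have hh := fun i j => (hX.contDiffAt_secondForm hu i j).differentiableAt_top
  have hm : pd k (meanVector X) u = (1 / 2 : ℝ) • ∑ i, ∑ j,
      (pd k (fun w => (metric X w)⁻¹ i j) u • secondForm X i j u +
        (metric X u)⁻¹ i j • pd k (secondForm X i j) u) := by
    have d := fun i j => (hG i j).smul (hh i j)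
    refine (pd_smul (differentiableAt_const _) (DifferentiableAt.fun_sum fun i _ =>
      DifferentiableAt.fun_sum fun j _ => d i j)).trans ?_
    rw [pd_const, zero_smul, zero_add, pd_sum fun i _ => DifferentiableAt.fun_sum fun j _ => d i j]
    congr 1
    refine Finset.sum_congr rfl fun i _ => (pd_sum fun j _ => d i j).trans ?_
    exact Finset.sum_congr rfl fun j _ => pd_smul (hG i j) (hh i j)
  have hX0 : ∀ i j, normalPart X u (pd k (pd i (pd j X)) u) = ambientCubic X i j k u +
      (∑ l, (christoffel X l i j u * metric X u l k + christoffel X l i k u * metric X u j l +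
        christoffel X l j k u * metric X u i l)) • X u := fun i j => by
    rw [hX.ambientCubic_comm_right hu, hX.ambientCubic_comm_left hu, ambientCubic]
    have : (∑ l, (christoffel X l k i u * metric X u l j + christoffel X l k j u * metric X u i l +
        christoffel X l i j u * metric X u k l)) = ∑ l, (christoffel X l i j u * metric X u l k +
        christoffel X l i k u * metric X u j l + christoffel X l j k u * metric X u i l) :=
      Finset.sum_congr rfl fun l _ => by
        rw [hX.christoffel_comm hu l k i, hX.christoffel_comm hu l k j, metric_comm X u l j,
          metric_comm X u k l]
        ring
    rw [this]
    module
  have hB : ∀ i j, secondForm X i j u = ambientForm X i j u + metric X u i j • X u := fun i j => by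
    rw [ambientForm]; module
  rw [hm]
  simp only [normalPart_smul, normalPart_add, normalPart_sum, hX.normalPart_secondForm hu,
    hX.normalPart_pd_secondForm hu, hX0, hX.pd_inv_metric hu]
  -- The multiples of X introduced here cancel because the metric is parallel.
  simp only [hB]
  have e1 := metric_inv_comm X u 1 0
  have e2 := metric_comm X u 1 0
  have e3 := fun l => hX.christoffel_comm hu l 1 0
  have e4 := hX.ambientForm_comm hu 1 0
  have e5 := fun k => hX.ambientCubic_comm_left hu 1 0 k
  have e6 := fun k => hX.ambientCubic_comm_right hu k 1 0
  fin_cases k <;> simp only [Fin.sum_univ_two, e1, e2, e3, e4, e5, e6, Fin.zero_eta, Fin.mk_one]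
    <;> module

/-- Contracting g⁻¹ with g leaves the cross terms -h₁₀ ∧ X and -X ∧ h₀₁, which cancel by symmetry of
h; the X ∧ X terms are zero. -/
theorem sum_inv_mul_form {η : Mink →L[ℝ] Mink →L[ℝ] ℝ} (hη : ∀ v, η v v = 0) :
    ∑ i, ∑ j, (metric X u)⁻¹ i j * η (ambientForm X i 0 u) (ambientForm X j 1 u) =
      ∑ i, ∑ j, (metric X u)⁻¹ i j * η (secondForm X i 0 u) (secondForm X j 1 u) := by
  have h00 := hX.sum_inv_metric hu 0 0
  have h01 := hX.sum_inv_metric hu 0 1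
  have h10 := hX.sum_inv_metric hu 1 0
  have h11 := hX.sum_inv_metric hu 1 1
  simp only [ambientForm, Fin.sum_univ_two, map_sub, map_smul, sub_apply,
    smul_apply, smul_eq_mul, hη, apply_swap_of_alternating hη (X u),
    metric_comm X u 1 0, metric_inv_comm X u 1 0, hX.secondForm_comm hu 1 0] at *
  simp at h00 h01 h10 h11
  linear_combination (η (secondForm X 0 1 u) (X u)) * (h00 - h11) +
    (η (secondForm X 1 1 u) (X u)) * h10 - (η (secondForm X 0 0 u) (X u)) * h01

/-- The 2 is the trace of the identity of the tangent plane, coming from the summand -gᵢⱼ X of the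
ambient form. -/
theorem sum_inv_mul_lor_ambientForm :
    ∑ i, ∑ j, ∑ k, ∑ l, (metric X u)⁻¹ i j * (metric X u)⁻¹ k l *
      lor (ambientForm X j k u) (ambientForm X i l u) = formNormSq X u + 2 := by
  have h00 := hX.sum_inv_metric hu 0 0
  have h01 := hX.sum_inv_metric hu 0 1
  have h10 := hX.sum_inv_metric hu 1 0
  have h11 := hX.sum_inv_metric hu 1 1
  simp only [hX.lor_ambientForm hu, formNormSq, Fin.sum_univ_two,
    metric_comm X u 1 0, metric_inv_comm X u 1 0, hX.secondForm_comm hu 1 0,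
    lor_comm (secondForm X 0 1 u) (secondForm X 0 0 u),
    lor_comm (secondForm X 1 1 u) (secondForm X 0 0 u),
    lor_comm (secondForm X 1 1 u) (secondForm X 0 1 u)] at *
  simp at h00 h01 h10 h11
  set a := (metric X u)⁻¹ 0 0
  set b := (metric X u)⁻¹ 0 1
  set c := (metric X u)⁻¹ 1 1
  set p := metric X u 0 0
  set q := metric X u 0 1
  set r := metric X u 1 1
  linear_combination (a * p + b * q + 1) * h00 + (b * q + c * r + 1) * h11 +
    (a * q + b * r) * h10 + (b * p + c * q) * h01

/-- The Laplacian of the Gauss map. -/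
theorem laplace_gaussForm {η : Mink →L[ℝ] Mink →L[ℝ] ℝ} (hη : ∀ v, η v v = 0) :
    laplace X (gaussForm X η) u = (formNormSq X u + 2) * gaussForm X η u -
      2 * (√(metric X u).det)⁻¹ * (η (normalPart X u (pd 0 (meanVector X) u)) (pd 1 X u) +
        η (pd 0 X u) (normalPart X u (pd 1 (meanVector X) u)) +
        ∑ i, ∑ j, (metric X u)⁻¹ i j * η (secondForm X i 0 u) (secondForm X j 1 u)) := by
  have key := laplace_algebra hη (fun i => pd i X u) (fun i j => ambientForm X i j u)
    (fun i j k => ambientCubic X i j k u) (fun i j k => christoffel X i j k u)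
    (fun i j => (metric X u)⁻¹ i j)
    (fun i j k l => lor (ambientForm X i j u) (ambientForm X k l u)) (√(metric X u).det)⁻¹
    (hX.ambientForm_comm hu 1 0) (fun i => hX.ambientCubic_comm_right hu i 1 0)
    (fun i => hX.ambientCubic_comm_left hu 1 0 i) (fun k => hX.christoffel_comm hu k 1 0)
    (metric_inv_comm X u 1 0)
  beta_reduce at key
  rw [← hX.normalPart_pd_meanVector hu, ← hX.normalPart_pd_meanVector hu,
    hX.sum_inv_mul_lor_ambientForm hu, hX.sum_inv_mul_form hu hη] at key
  simp only [laplace, hX.pd_pd_gaussForm hu hη, hX.pd_gaussForm hu hη, hX.pd_ambientForm hu,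
    hX.pd_pd_eq_ambient hu]
  rw [key, gaussForm]
  simp only [map_smul, smul_apply, smul_eq_mul]
  ring

end IsSpacelikeOn


/-! ### The normal plane and the Ricci equation -/

namespace IsSpacelikeOn

variable {X : Plane → Mink} {V : Set Plane} (hX : IsSpacelikeOn X V) {u : Plane} (hu : u ∈ V)

include hX hu

theorem contDiffAt_meanVector : ContDiffAt ℝ ∞ (meanVector X) u := by
  unfold meanVector
  exact (contDiffAt_const (c := (1 / 2 : ℝ))).smul (ContDiffAt.sum fun i _ =>
    ContDiffAt.sum fun j _ => (hX.contDiffAt_inv hu i j).smul (hX.contDiffAt_secondForm hu i j))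

theorem contDiffAt_formNormSq : ContDiffAt ℝ ∞ (formNormSq X) u :=
  ContDiffAt.sum fun i _ => ContDiffAt.sum fun j _ => ContDiffAt.sum fun k _ =>
    ContDiffAt.sum fun l _ => ((hX.contDiffAt_inv hu i j).mul (hX.contDiffAt_inv hu k l)).mul
      ((hX.contDiffAt_secondForm hu i k).lor (hX.contDiffAt_secondForm hu j l))

theorem lor_meanVector_self : lor (meanVector X u) (X u) = 0 := by
  simp [meanVector, hX.lor_secondForm_self hu]

theorem lor_meanVector_pd (k : Fin 2) : lor (meanVector X u) (pd k X u) = 0 := by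
  simp [meanVector, hX.lor_secondForm_pd hu]

/-- The normal spaces are planes, so that alternating trilinear forms on them vanish. -/
theorem normal_trilinear_eq_zero {η : Mink →L[ℝ] Mink →L[ℝ] ℝ} (hη : ∀ v, η v v = 0)
    (ξ a b c : Mink) (ha : normalPart X u a = a) (hb : normalPart X u b = b)
    (hc : normalPart X u c = c) :
    lor ξ a * η b c + lor ξ b * η c a + lor ξ c * η a b = 0 := by
  -- Six vectors in a space of dimension five. Pairing the relation with X, ∂₀X, ∂₁X kills its first
  -- three coefficients, leaving a nontrivial relation among `a`, `b`, `c`.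
  have hdep : ¬LinearIndependent ℝ ![X u, pd 0 X u, pd 1 X u, a, b, c] := fun h => by
    have := h.fintype_card_le_finrank
    simp at this
  obtain ⟨g, hg, hi⟩ := Fintype.not_linearIndependent_iff.1 hdep
  have hn0 := fun w => hX.lor_normalPart_self hu w
  have hn1 := fun w k => hX.lor_normalPart_pd hu w k
  have e0 : ∀ y, lor (∑ i, g i • ![X u, pd 0 X u, pd 1 X u, a, b, c] i) y = 0 := fun y => by
    rw [hg, lor_zero_left]
  simp [Fin.sum_univ_succ] at e0 hg
  have hself : ∀ k, lor (pd k X u) (X u) = 0 := fun k => (lor_comm _ _).trans (hX.lor_pd hu k)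
  have hna := hn0 a
  have hnb := hn0 b
  have hnc := hn0 c
  have hna1 := hn1 a
  have hnb1 := hn1 b
  have hnc1 := hn1 c
  rw [ha] at hna hna1
  rw [hb] at hnb hnb1
  rw [hc] at hnc hnc1
  have f := e0 (X u)
  have f0 := e0 (pd 0 X u)
  have f1 := e0 (pd 1 X u)
  simp only [hself, hna, hnb, hnc, hX.sphere u hu] at f
  simp only [hX.lor_pd hu, hna1, hnb1, hnc1, ← metric_apply] at f0 f1
  have hd := (hX.det_pos u hu).ne'
  rw [Matrix.det_fin_two] at hd
  have g0 : g 0 = 0 := by linarith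
  have g1 : g 1 = 0 := by
    refine (mul_eq_zero.1 (?_ : (metric X u 0 0 * metric X u 1 1 -
      metric X u 0 1 * metric X u 1 0) * g 1 = 0)).resolve_left hd
    linear_combination metric X u 1 1 * f0 - metric X u 1 0 * f1
  have g2 : g 2 = 0 := by
    refine (mul_eq_zero.1 (?_ : (metric X u 0 0 * metric X u 1 1 -
      metric X u 0 1 * metric X u 1 0) * g 2 = 0)).resolve_left hd
    linear_combination metric X u 0 0 * f1 - metric X u 0 1 * f0
  rw [g0, g1, g2] at hg
  simp only [zero_smul, zero_add] at hg
  have k := fun v => congrArg (fun y => η v y) hg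
  have m := congrArg (fun y => lor ξ y) hg
  simp at k m
  have hne : g 3 ≠ 0 ∨ g 4 ≠ 0 ∨ g 5 ≠ 0 := by
    by_contra! hcon
    obtain ⟨i, hi⟩ := hi
    fin_cases i <;> simp_all
  have s1 := apply_swap_of_alternating hη b a
  have s2 := apply_swap_of_alternating hη c b
  have s3 := apply_swap_of_alternating hη c a
  have ka := k a
  have kb := k b
  have kc := k c
  simp only [hη, s1, s2, s3] at ka kb kc ⊢
  -- Multiplied by a nonzero coefficient, the claim is a combination of the images of the relation
  -- under ⟨ξ, ·⟩ and under η with one slot filled.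
  rcases hne with h | h | h <;> refine mul_left_cancel₀ h ?_ <;> rw [mul_zero]
  · linear_combination η b c * m + lor ξ b * kc - lor ξ c * kb
  · linear_combination -η a c * m + lor ξ c * ka - lor ξ a * kc
  · linear_combination η a b * m + lor ξ a * kb - lor ξ b * ka

theorem pd_meanVector (k : Fin 2) :
    pd k (meanVector X) u = normalPart X u (pd k (meanVector X) u) -
      ∑ m, (∑ l, (metric X u)⁻¹ m l * lor (meanVector X u) (secondForm X k l u)) •
        pd m X u := by
  have hs := hX.smooth u hu
  have dH := (hX.contDiffAt_meanVector hu).differentiableAt_top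
  have h1 : lor (pd k (meanVector X) u) (X u) = 0 := by
    have h : (fun w => lor (meanVector X w) (X w)) =ᶠ[𝓝 u] fun _ => 0 :=
      hX.eventually hu fun w hw => hX.lor_meanVector_self hw
    have h2 := pd_congr (i := k) h
    rwa [pd_const, pd_lor dH (hX.diff hu), hX.lor_meanVector_pd hu, add_zero] at h2
  have h2 : ∀ l, lor (pd k (meanVector X) u) (pd l X u) =
      -lor (meanVector X u) (secondForm X k l u) := fun l => by
    have h : (fun w => lor (meanVector X w) (pd l X w)) =ᶠ[𝓝 u] fun _ => 0 :=
      hX.eventually hu fun w hw => hX.lor_meanVector_pd hw l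
    have h2 := pd_congr (i := k) h
    rw [pd_const, pd_lor dH (hs.pd l).differentiableAt_top, hX.pd_pd_eq hu] at h2
    simp [hX.lor_meanVector_self hu, hX.lor_meanVector_pd hu] at h2
    linarith
  simp only [normalPart, h1, h2, Fin.sum_univ_two]
  module

/-- A consequence of the Ricci equation: if the mean curvature vector is parallel, its curvature
in the normal bundle vanishes. -/
theorem ricci_of_parallel
    (hD : ∀ w ∈ V, ∀ k, normalPart X w (pd k (meanVector X) w) = 0) :
    ∑ m, (∑ l, (metric X u)⁻¹ m l * lor (meanVector X u) (secondForm X 0 l u)) •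
        secondForm X 1 m u =
      ∑ m, (∑ l, (metric X u)⁻¹ m l * lor (meanVector X u) (secondForm X 1 l u)) •
        secondForm X 0 m u := by
  -- As DH = 0 near `u`, the derivative of H is tangential there, and the normal part of the
  -- derivative of a tangential field only involves h.
  have key : ∀ i j, normalPart X u (pd j (pd i (meanVector X)) u) =
      -∑ m, (∑ l, (metric X u)⁻¹ m l * lor (meanVector X u) (secondForm X i l u)) •
        secondForm X j m u := fun i j => by
    have h : pd i (meanVector X) =ᶠ[𝓝 u] fun w => ∑ m, (-∑ l, (metric X w)⁻¹ m l *
        lor (meanVector X w) (secondForm X i l w)) • pd m X w :=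
      hX.eventually hu fun w hw => by
        beta_reduce
        rw [hX.pd_meanVector hw, hD w hw]
        simp only [neg_smul, Finset.sum_neg_distrib, zero_sub]
    have d1 : ∀ m, DifferentiableAt ℝ (fun w => -∑ l, (metric X w)⁻¹ m l *
        lor (meanVector X w) (secondForm X i l w)) u := fun m =>
      (ContDiffAt.neg (ContDiffAt.sum fun l _ => (hX.contDiffAt_inv hu m l).mul
        ((hX.contDiffAt_meanVector hu).lor
          (hX.contDiffAt_secondForm hu i l)))).differentiableAt_top
    have d2 := fun m => (hX.contDiffAt_pd hu m).differentiableAt_top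
    rw [pd_congr h, pd_sum fun m _ => (d1 m).fun_smul (d2 m)]
    simp only [pd_smul (d1 _) (d2 _)]
    simp only [normalPart_sum, normalPart_neg, normalPart_add, normalPart_smul,
      hX.normalPart_pd hu, normalPart_pd_pd, smul_zero, zero_add, neg_smul,
      Finset.sum_neg_distrib]
  have h := key 0 1
  rw [pd_comm (hX.contDiffAt_meanVector hu), key 1 0] at h
  exact (neg_injective h).symm

/-- Take a normal `c` with ⟨H, c⟩ ≠ 0; H itself would not do if light-like. Contracting the
trilinear identity for hᵢ₀, hⱼ₁, `c` with gⁱʲ gives ⟨H, c⟩ times the sum plus two terms that cancel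
by `ricci_of_parallel`. -/
theorem sum_inv_mul_form_eq_zero {η : Mink →L[ℝ] Mink →L[ℝ] ℝ} (hη : ∀ v, η v v = 0)
    (hD : ∀ w ∈ V, ∀ k, normalPart X w (pd k (meanVector X) w) = 0)
    (hH : meanVector X u ≠ 0) :
    ∑ i, ∑ j, (metric X u)⁻¹ i j * η (secondForm X i 0 u) (secondForm X j 1 u) = 0 := by
  obtain ⟨w, hw⟩ := exists_lor_ne_zero hH
  rw [← lor_normalPart_of_orthogonal (hX.lor_meanVector_self hu) (hX.lor_meanVector_pd hu)] at hw
  set c := normalPart X u w with hc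
  have ht := fun i j => hX.normal_trilinear_eq_zero hu hη (meanVector X u)
    (secondForm X i 0 u) (secondForm X j 1 u) c (hX.normalPart_secondForm hu i 0)
    (hX.normalPart_secondForm hu j 1) (hX.normalPart_normalPart hu w)
  have hr := congrArg (fun v => η c v) (hX.ricci_of_parallel hu hD)
  refine (mul_eq_zero.1 (?_ : lor (meanVector X u) c * _ = 0)).resolve_left hw
  have h00 := ht 0 0
  have h01 := ht 0 1
  have h10 := ht 1 0
  have h11 := ht 1 1
  simp only [Fin.sum_univ_two, map_add, map_smul, smul_eq_mul, apply_swap_of_alternating hη _ c,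
    hX.secondForm_comm hu 1 0, metric_inv_comm X u 1 0] at hr h00 h01 h10 h11 ⊢
  linear_combination (metric X u)⁻¹ 0 0 * h00 + (metric X u)⁻¹ 0 1 * (h01 + h10) +
    (metric X u)⁻¹ 1 1 * h11 + hr

end IsSpacelikeOn


/-! ### Changes of coordinates -/

/-- The Jacobian matrix of a map of the plane. -/
def jacobian (φ : Plane → Plane) (u : Plane) : Matrix (Fin 2) (Fin 2) ℝ :=
  .of fun k i => pd i φ u k

theorem det_jacobian (φ : Plane → Plane) (u : Plane) :
    (jacobian φ u).det = (fderiv ℝ φ u).det := by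
  rw [ContinuousLinearMap.det,
    ← LinearMap.det_toMatrix (EuclideanSpace.basisFun (Fin 2) ℝ).toBasis]
  congr 1

theorem pd_comp {F : Type*} [NormedAddCommGroup F] [NormedSpace ℝ F] {φ : Plane → Plane}
    {Y : Plane → F} {u : Plane} (hφ : DifferentiableAt ℝ φ u) (hY : DifferentiableAt ℝ Y (φ u))
    (i : Fin 2) :
    pd i (fun w => Y (φ w)) u = ∑ k, jacobian φ u k i • pd k Y (φ u) := by
  rw [pd, fderiv_fun_comp u hY hφ, ContinuousLinearMap.comp_apply, fderiv_eq_sum_pd]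
  rfl

namespace IsSpacelikeOn

variable {X Y : Plane → Mink} {V : Set Plane} {φ : Plane → Plane} {u : Plane}
  (hX : IsSpacelikeOn X V) (hφ : ContDiffAt ℝ ∞ φ u) (hu : φ u ∈ V)
  (hY : Y =ᶠ[𝓝 u] fun w => X (φ w)) (hA : (jacobian φ u).det ≠ 0)

include hX hφ hu hY

theorem pd_reparam (i : Fin 2) : pd i Y u = ∑ k, jacobian φ u k i • pd k X (φ u) := by
  rw [pd_congr hY, pd_comp hφ.differentiableAt_top (hX.diff hu)]

theorem metric_reparam :
    metric Y u = (jacobian φ u).transpose * metric X (φ u) * jacobian φ u := by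
  ext i j
  simp only [metric_apply, hX.pd_reparam hφ hu hY, Matrix.mul_apply, Fin.sum_univ_two,
    Matrix.transpose_apply, lor_add_left, lor_add_right, lor_smul_left, lor_smul_right]
  ring

theorem pd_pd_reparam (i j : Fin 2) :
    pd i (pd j Y) u = ∑ k, (∑ l, (jacobian φ u k i * jacobian φ u l j) • pd k (pd l X) (φ u)) +
      ∑ l, pd i (fun w => jacobian φ w l j) u • pd l X (φ u) := by
  have h : pd j Y =ᶠ[𝓝 u] fun w => ∑ l, jacobian φ w l j • pd l X (φ w) := by
    have h1 : ∀ᶠ w in 𝓝 u, ContDiffAt ℝ 1 φ w :=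
      (hφ.of_le (by simp)).eventually (by simp)
    have h2 : ∀ᶠ w in 𝓝 u, φ w ∈ V := hφ.continuousAt (hX.isOpen.mem_nhds hu)
    filter_upwards [h1, h2, hY.eventuallyEq_nhds] with w hw1 hw2 hw3
    rw [pd_congr hw3, pd_comp (hw1.differentiableAt (by simp)) (hX.diff hw2)]
  have d1 : ∀ l, DifferentiableAt ℝ (fun w => jacobian φ w l j) u := fun l =>
    ((EuclideanSpace.proj (𝕜 := ℝ) l).contDiff.contDiffAt.comp u (hφ.pd j)).differentiableAt_top
  have d2 := fun l => (hX.contDiffAt_pd hu l).differentiableAt_top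
  have d3 : ∀ l, DifferentiableAt ℝ (fun w => pd l X (φ w)) u := fun l =>
    (d2 l).fun_comp' u hφ.differentiableAt_top
  rw [pd_congr h, pd_sum fun l _ => (d1 l).fun_smul (d3 l)]
  simp only [pd_smul (d1 _) (d3 _), pd_comp hφ.differentiableAt_top (d2 _), Fin.sum_univ_two]
  module

include hA

/-- Solved for the inverse metric of `X`, so that the invariance proofs below become polynomial
identities in the Jacobian. -/
theorem metric_inv_reparam (k l : Fin 2) :
    (metric X (φ u))⁻¹ k l =
      ∑ i, ∑ j, jacobian φ u k i * (metric Y u)⁻¹ i j * jacobian φ u l j := by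
  have h : jacobian φ u * (metric Y u)⁻¹ * (jacobian φ u).transpose = (metric X (φ u))⁻¹ := by
    have hA1 : jacobian φ u * (jacobian φ u)⁻¹ = 1 := Matrix.mul_nonsing_inv _ hA.isUnit
    have hA2 : (jacobian φ u).transpose⁻¹ * (jacobian φ u).transpose = 1 :=
      Matrix.nonsing_inv_mul _ (by rw [Matrix.det_transpose]; exact hA.isUnit)
    rw [hX.metric_reparam hφ hu hY, Matrix.mul_inv_rev, Matrix.mul_inv_rev, ← Matrix.mul_assoc,
      hA1, Matrix.one_mul, Matrix.mul_assoc, hA2, Matrix.mul_one]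
  rw [← h]
  simp only [Matrix.mul_apply, Matrix.transpose_apply, Finset.sum_mul]
  exact Finset.sum_comm

theorem normalPart_reparam (w : Mink) : normalPart Y u w = normalPart X (φ u) w := by
  have h0 : Y u = X (φ u) := hY.eq_of_nhds
  simp only [normalPart, hX.metric_inv_reparam hφ hu hY hA, hX.pd_reparam hφ hu hY, h0,
    Fin.sum_univ_two, lor_add_right, lor_smul_right]
  module

/-- The second derivatives of `φ` multiply only tangent vectors, which the normal projection kills.
-/
theorem secondForm_reparam (i j : Fin 2) :
    secondForm Y i j u =
      ∑ k, ∑ l, (jacobian φ u k i * jacobian φ u l j) • secondForm X k l (φ u) := by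
  rw [secondForm, hX.pd_pd_reparam hφ hu hY, hX.normalPart_reparam hφ hu hY hA]
  simp only [normalPart_add, normalPart_sum, normalPart_smul, hX.normalPart_pd hu, smul_zero,
    Finset.sum_const_zero, add_zero, normalPart_pd_pd]

theorem meanVector_reparam : meanVector Y u = meanVector X (φ u) := by
  simp only [meanVector, hX.metric_inv_reparam hφ hu hY hA, hX.secondForm_reparam hφ hu hY hA,
    Fin.sum_univ_two]
  module

theorem formNormSq_reparam : formNormSq Y u = formNormSq X (φ u) := by
  simp only [formNormSq, hX.metric_inv_reparam hφ hu hY hA, hX.secondForm_reparam hφ hu hY hA,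
    Fin.sum_univ_two, lor_add_left, lor_add_right, lor_smul_left, lor_smul_right]
  ring

omit hA

/-- The area factor scales by |det|⁻¹ and the wedge by det, whence the sign condition. -/
theorem gaussForm_reparam (hA : 0 < (jacobian φ u).det) {η : Mink →L[ℝ] Mink →L[ℝ] ℝ}
    (hη : ∀ v, η v v = 0) : gaussForm Y η u = gaussForm X η (φ u) := by
  have hd : (metric Y u).det = (jacobian φ u).det ^ 2 * (metric X (φ u)).det := by
    rw [hX.metric_reparam hφ hu hY, Matrix.det_mul, Matrix.det_mul, Matrix.det_transpose]
    ring
  have hw : η (pd 0 Y u) (pd 1 Y u) =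
      (jacobian φ u).det * η (pd 0 X (φ u)) (pd 1 X (φ u)) := by
    simp only [hX.pd_reparam hφ hu hY, Fin.sum_univ_two, map_add, map_smul, add_apply, smul_apply,
      smul_eq_mul, hη, apply_swap_of_alternating hη (pd 1 X (φ u)) (pd 0 X (φ u)),
      Matrix.det_fin_two]
    ring
  rw [gaussForm, gaussForm, hd, hw, Real.sqrt_mul (sq_nonneg _), Real.sqrt_sq hA.le]
  field_simp

include hA

theorem normalPart_pd_meanVector_reparam
    (hH : meanVector Y =ᶠ[𝓝 u] fun w => meanVector X (φ w))
    (h : ∀ i, normalPart Y u (pd i (meanVector Y) u) = 0) (k : Fin 2) :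
    normalPart X (φ u) (pd k (meanVector X) (φ u)) = 0 := by
  have h1 := fun i => h i
  simp only [pd_congr hH, pd_comp hφ.differentiableAt_top
    (hX.contDiffAt_meanVector hu).differentiableAt_top, hX.normalPart_reparam hφ hu hY hA,
    Fin.sum_univ_two, normalPart_add, normalPart_smul] at h1
  rw [Matrix.det_fin_two] at hA
  have h0 := h1 0
  have h1 := h1 1
  refine (smul_eq_zero.1 (?_ : (jacobian φ u 0 0 * jacobian φ u 1 1 -
    jacobian φ u 0 1 * jacobian φ u 1 0) • normalPart X (φ u) (pd k (meanVector X) (φ u)) =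
      0)).resolve_left hA
  fin_cases k <;> simp only [Fin.zero_eta, Fin.mk_one]
  · linear_combination (norm := module) jacobian φ u 1 1 • h0 - jacobian φ u 1 0 • h1
  · linear_combination (norm := module) jacobian φ u 0 0 • h1 - jacobian φ u 0 1 • h0

end IsSpacelikeOn


/-! ### From the surface to its parametrizations -/

section Charts

variable {M : Type*} [TopologicalSpace M] [ChartedSpace Plane M]

theorem wedge_add_left (u v w : Mink) : wedge (u + v) w = wedge u w + wedge v w := by
  simpa [wedge] using
    (exteriorPower.ιMulti ℝ 2 (M := Mink)).map_vecCons_add (m := ![w]) (x := u) (y := v)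

theorem wedge_smul_left (s : ℝ) (u w : Mink) : wedge (s • u) w = s • wedge u w := by
  simpa [wedge] using
    (exteriorPower.ιMulti ℝ 2 (M := Mink)).map_vecCons_smul (m := ![w]) (c := s) (x := u)

theorem wedge_swap (u w : Mink) : wedge u w = -wedge w u := by
  have := (exteriorPower.ιMulti ℝ 2 (M := Mink)).map_swap ![w, u] (i := 0) (j := 1) (by simp)
  rw [wedge, wedge, ← this]
  congr 1
  ext i
  fin_cases i <;> rfl

theorem wedge_add_right (u v w : Mink) : wedge u (v + w) = wedge u v + wedge u w := by
  rw [wedge_swap, wedge_add_left, neg_add, ← wedge_swap, ← wedge_swap]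

theorem wedge_smul_right (s : ℝ) (u w : Mink) : wedge u (s • w) = s • wedge u w := by
  rw [wedge_swap, wedge_smul_left, wedge_swap u w, smul_neg]

/-- The bilinear form corresponding to a linear form on bivectors. -/
def wedgeForm (ℓ : Module.Dual ℝ Bivector) : Mink →L[ℝ] Mink →L[ℝ] ℝ :=
  LinearMap.toContinuousBilinearMap <| LinearMap.mk₂ ℝ (fun v w => ℓ (wedge v w))
    (fun u v w => by rw [wedge_add_left, map_add])
    (fun c v w => by rw [wedge_smul_left, map_smul])
    (fun u v w => by rw [wedge_add_right, map_add])
    (fun c v w => by rw [wedge_smul_right, map_smul])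

theorem wedgeForm_apply (ℓ : Module.Dual ℝ Bivector) (v w : Mink) :
    wedgeForm ℓ v w = ℓ (wedge v w) := rfl

theorem wedgeForm_self (ℓ : Module.Dual ℝ Bivector) (v : Mink) : wedgeForm ℓ v v = 0 := by
  rw [wedgeForm_apply, wedge, AlternatingMap.map_eq_zero_of_eq _ ![v, v] (i := 0) (j := 1) rfl
    (by simp), map_zero]

theorem map_gaussMap (ℓ : Module.Dual ℝ Bivector) (x : M → Mink) (p : M) :
    ℓ (gaussMap x p) = gaussForm (inChart x p) (wedgeForm ℓ) (coord p) := by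
  simp [gaussMap, gaussForm, wedgeForm_apply]

theorem meanCurvature_eq (x : M → Mink) (p : M) :
    meanCurvature x p = meanVector (inChart x p) (coord p) := rfl

theorem laplace_congr {X : Plane → Mink} {φ ψ : Plane → ℝ} {u : Plane} (h : φ =ᶠ[𝓝 u] ψ) :
    laplace X φ u = laplace X ψ u := by
  simp only [laplace, pd_congr h, pd_congr (pd_eventuallyEq h)]

/-- The part of the chart at `p` where the induced metric is nondegenerate. -/
def chartDomain (x : M → Mink) (p : M) : Set Plane :=
  {u | u ∈ (chartAt Plane p).target ∧ 0 < (metric (inChart x p) u).det}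

theorem pd_inChart_eq_mfderiv {F : Type*} [NormedAddCommGroup F] [NormedSpace ℝ F] {y : M → F}
    {p : M} (hy : ContMDiffAt (𝓡 2) 𝓘(ℝ, F) ∞ y p) (v : TangentSpace (𝓡 2) p) :
    mfderiv (𝓡 2) 𝓘(ℝ, F) y p v =
      ∑ k, (show Plane from v) k • pd k (inChart y p) (coord p) := by
  rw [← fderiv_eq_sum_pd, (hy.mdifferentiableAt (by simp)).mfderiv]
  simp [writtenInExtChartAt, inChart, coord, fderivWithin_univ, extChartAt]
  rfl

variable [IsManifold (𝓡 2) ∞ M] {x : M → Mink} (hx : IsSpacelikeSurface x) (p : M)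

include hx

theorem contDiffAt_inChart {u : Plane} (hu : u ∈ (chartAt Plane p).target) :
    ContDiffAt ℝ ∞ (inChart x p) u := by
  have h : ContMDiffAt (𝓡 2) (𝓡 2) ∞ (chartAt Plane p).symm u :=
    contMDiffOn_chart_symm.contMDiffAt ((chartAt Plane p).open_target.mem_nhds hu)
  exact contMDiffAt_iff_contDiffAt.1 (hx.smooth.contMDiffAt.comp u h)

theorem isSpacelikeOn_chartDomain : IsSpacelikeOn (inChart x p) (chartDomain x p) where
  isOpen := isOpen_iff_mem_nhds.2 fun _ hu =>
    Filter.inter_mem ((chartAt Plane p).open_target.mem_nhds hu.1)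
      ((contDiffAt_det_metric (contDiffAt_inChart hx p hu.1)).continuousAt.eventually_const_lt hu.2)
  smooth _ hu := contDiffAt_inChart hx p hu.1
  sphere _ _ := hx.mem_deSitter _
  det_pos _ hu := hu.2

omit [IsManifold (𝓡 2) ∞ M] in
theorem coord_mem_chartDomain : coord p ∈ chartDomain x p := by
  refine ⟨mem_chart_target Plane p, ?_⟩
  have key : ∀ a b : ℝ, (a ≠ 0 ∨ b ≠ 0) →
      0 < lor (a • pd 0 (inChart x p) (coord p) + b • pd 1 (inChart x p) (coord p))
        (a • pd 0 (inChart x p) (coord p) + b • pd 1 (inChart x p) (coord p)) := by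
    intro a b hab
    have hv : (!₂[a, b] : Plane) ≠ 0 := fun h => by
      have h0 := congrArg (fun v : Plane => v 0) h
      have h1 := congrArg (fun v : Plane => v 1) h
      simp at h0 h1
      simp [h0, h1] at hab
    have hpos : ∀ v : TangentSpace (𝓡 2) p, v ≠ 0 → _ := hx.pos p
    simp only [mfderiv_eq_pd hx.smooth] at hpos
    simpa using hpos (!₂[a, b] : Plane) hv
  have h1 := key 0 1 (by simp)
  -- On the vector (g₁₁, -g₀₁) the metric takes the value g₁₁ det g.
  have h2 := key (lor (pd 1 (inChart x p) (coord p)) (pd 1 (inChart x p) (coord p)))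
    (-lor (pd 0 (inChart x p) (coord p)) (pd 1 (inChart x p) (coord p)))
    (Or.inl (by simpa using h1.ne'))
  rw [Matrix.det_fin_two]
  simp only [metric_apply, zero_smul, zero_add, one_smul, lor_add_left, lor_add_right,
    lor_smul_left, lor_smul_right,
    lor_comm (pd 1 (inChart x p) (coord p)) (pd 0 (inChart x p) (coord p))] at *
  refine (pos_iff_pos_of_mul_pos (?_ : 0 < lor (pd 1 (inChart x p) (coord p))
    (pd 1 (inChart x p) (coord p)) * _)).1 h1
  convert h2 using 1
  ring

omit hx in
theorem contDiffAt_transition (q : M) {w : Plane}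
    (hw : w ∈ ((chartAt Plane q).symm.trans (chartAt Plane p)).source) :
    ContDiffAt ℝ ∞ ((chartAt Plane q).symm.trans (chartAt Plane p)) w := by
  have h1 : ContMDiffAt (𝓡 2) (𝓡 2) ∞ (chartAt Plane q).symm w :=
    contMDiffOn_chart_symm.contMDiffAt ((chartAt Plane q).open_target.mem_nhds (by simp_all))
  have h2 : ContMDiffAt (𝓡 2) (𝓡 2) ∞ (chartAt Plane p) ((chartAt Plane q).symm w) :=
    contMDiffOn_chart.contMDiffAt ((chartAt Plane p).open_source.mem_nhds (by simp_all))
  exact contMDiffAt_iff_contDiffAt.1 (h2.comp w h1)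

omit hx [IsManifold (𝓡 2) ∞ M] in
theorem inChart_transition (y : M → Mink) (q : M) {w : Plane}
    (hw : w ∈ ((chartAt Plane q).symm.trans (chartAt Plane p)).source) :
    inChart y q =ᶠ[𝓝 w]
      fun w => inChart y p ((chartAt Plane q).symm.trans (chartAt Plane p) w) := by
  filter_upwards [((chartAt Plane q).symm.trans (chartAt Plane p)).open_source.mem_nhds hw]
    with w hw
  have h : (chartAt Plane q).symm w ∈ (chartAt Plane p).source := by simp_all
  simp [inChart, h]

omit hx [IsManifold (𝓡 2) ∞ M] in
theorem det_jacobian_transition_pos (hM : OrientedAtlas M) (q : M) {w : Plane}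
    (hw : w ∈ ((chartAt Plane q).symm.trans (chartAt Plane p)).source) :
    0 < (jacobian ((chartAt Plane q).symm.trans (chartAt Plane p)) w).det := by
  rw [det_jacobian]
  exact hM _ (chart_mem_atlas _ _) _ (chart_mem_atlas _ _) w hw

variable {p} (hM : OrientedAtlas M) {w : Plane} (hw : w ∈ chartDomain x p)

omit hx [IsManifold (𝓡 2) ∞ M] in
include hw in
theorem transition_coord :
    coord ((chartAt Plane p).symm w) ∈
      ((chartAt Plane ((chartAt Plane p).symm w)).symm.trans (chartAt Plane p)).source ∧
    (chartAt Plane ((chartAt Plane p).symm w)).symm.trans (chartAt Plane p)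
      (coord ((chartAt Plane p).symm w)) = w := by
  have h1 := (chartAt Plane p).map_target hw.1
  have h2 := (chartAt Plane p).right_inv hw.1
  simp [coord, h1, h2]

include hM hw

theorem formNormSq_symm_apply :
    formNormSq (inChart x ((chartAt Plane p).symm w)) (coord ((chartAt Plane p).symm w)) =
      formNormSq (inChart x p) w := by
  obtain ⟨h1, h2⟩ := transition_coord hw
  rw [(isSpacelikeOn_chartDomain hx p).formNormSq_reparam (contDiffAt_transition p _ h1)
    (h2.symm ▸ hw) (inChart_transition p x _ h1) (det_jacobian_transition_pos p hM _ h1).ne', h2]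

theorem map_gaussMap_symm_apply (ℓ : Module.Dual ℝ Bivector) :
    ℓ (gaussMap x ((chartAt Plane p).symm w)) =
      gaussForm (inChart x p) (wedgeForm ℓ) w := by
  obtain ⟨h1, h2⟩ := transition_coord hw
  rw [map_gaussMap, (isSpacelikeOn_chartDomain hx p).gaussForm_reparam
    (contDiffAt_transition p _ h1) (h2.symm ▸ hw) (inChart_transition p x _ h1)
    (det_jacobian_transition_pos p hM _ h1) (wedgeForm_self ℓ), h2]

theorem meanCurvature_symm_apply :
    meanCurvature x ((chartAt Plane p).symm w) = meanVector (inChart x p) w := by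
  obtain ⟨h1, h2⟩ := transition_coord hw
  rw [meanCurvature_eq, (isSpacelikeOn_chartDomain hx p).meanVector_reparam
    (contDiffAt_transition p _ h1) (h2.symm ▸ hw) (inChart_transition p x _ h1)
    (det_jacobian_transition_pos p hM _ h1).ne', h2]

omit hw

theorem inChart_meanCurvature (p : M) :
    inChart (meanCurvature x) p =ᶠ[𝓝 (coord p)] meanVector (inChart x p) :=
  (isSpacelikeOn_chartDomain hx p).eventually (coord_mem_chartDomain hx p)
    fun _ hw => meanCurvature_symm_apply hx hM hw

omit hx hM [IsManifold (𝓡 2) ∞ M] in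
theorem eq_inChart_comp {F : Type*} (y : M → F) (p : M) :
    y =ᶠ[𝓝 p] fun q => inChart y p (chartAt Plane p q) := by
  filter_upwards [(chartAt Plane p).open_source.mem_nhds (mem_chart_source Plane p)] with q hq
  simp [inChart, hq]

omit hx hM in
theorem contMDiffAt_of_inChart {F : Type*} [NormedAddCommGroup F] [NormedSpace ℝ F] {y : M → F}
    {p : M} {Y : Plane → F} (hY : ContDiffAt ℝ ∞ Y (coord p))
    (h : inChart y p =ᶠ[𝓝 (coord p)] Y) : ContMDiffAt (𝓡 2) 𝓘(ℝ, F) ∞ y p := by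
  have hc : ContMDiffAt (𝓡 2) (𝓡 2) ∞ (chartAt Plane p) p :=
    contMDiffOn_chart.contMDiffAt
      ((chartAt Plane p).open_source.mem_nhds (mem_chart_source Plane p))
  have h2 : ContMDiffAt (𝓡 2) 𝓘(ℝ, F) ∞ (inChart y p) (chartAt Plane p p) :=
    contMDiffAt_iff_contDiffAt.2 (hY.congr_of_eventuallyEq h)
  exact (h2.comp p hc).congr_of_eventuallyEq (eq_inChart_comp y p)

theorem hasParallelMeanCurvature_iff : HasParallelMeanCurvature x ↔
    ∀ p k, normalPart (inChart x p) (coord p) (pd k (meanVector (inChart x p)) (coord p)) = 0 := by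
  refine forall_congr' fun p => ?_
  have hH := inChart_meanCurvature hx hM p
  have hs := contMDiffAt_of_inChart ((isSpacelikeOn_chartDomain hx p).contDiffAt_meanVector
    (coord_mem_chartDomain hx p)) hH
  simp only [pd_inChart_eq_mfderiv hs, pd_congr hH, normalPart_sum, normalPart_smul]
  refine ⟨fun h k => ?_, fun h v => by simp [h]⟩
  have := h (EuclideanSpace.single k 1 : Plane)
  simpa using this

/-- The Ricci argument differentiates DH = 0, so it is needed throughout the chart domain and not
only at `coord p`. -/
theorem normalPart_pd_meanVector_of_parallel (h : HasParallelMeanCurvature x) (p : M) {w : Plane}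
    (hw : w ∈ chartDomain x p) (k : Fin 2) :
    normalPart (inChart x p) w (pd k (meanVector (inChart x p)) w) = 0 := by
  obtain ⟨h1, h2⟩ := transition_coord hw
  rw [hasParallelMeanCurvature_iff hx hM] at h
  have hX := isSpacelikeOn_chartDomain hx p
  have hφ := contDiffAt_transition p _ h1
  have key := hX.normalPart_pd_meanVector_reparam hφ (h2.symm ▸ hw) (inChart_transition p x _ h1)
    (det_jacobian_transition_pos p hM _ h1).ne' ?_ (h _) k
  · rwa [h2] at key
  · have h3 := ((chartAt Plane ((chartAt Plane p).symm w)).symm.trans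
      (chartAt Plane p)).open_source.mem_nhds h1
    have h4 := hφ.continuousAt.preimage_mem_nhds (hX.isOpen.mem_nhds (h2.symm ▸ hw))
    filter_upwards [h3, h4] with v hv hv'
    exact hX.meanVector_reparam (contDiffAt_transition p _ hv) hv' (inChart_transition p x _ hv)
      (det_jacobian_transition_pos p hM _ hv).ne'

/-- The Laplacian of the Gauss map, contracted with a linear form on bivectors. -/
theorem laplaceEqAt_gaussMap_iff (p : M) (b : Bivector) :
    LaplaceEqAt x (gaussMap x) p b ↔ ∀ ℓ : Module.Dual ℝ Bivector,
      laplace (inChart x p) (gaussForm (inChart x p) (wedgeForm ℓ)) (coord p) = ℓ b := by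
  refine forall_congr' fun ℓ => ?_
  rw [laplace_congr ((isSpacelikeOn_chartDomain hx p).eventually (coord_mem_chartDomain hx p)
    fun w hw => map_gaussMap_symm_apply hx hM hw ℓ :
    inChart (fun q => ℓ (gaussMap x q)) p =ᶠ[𝓝 (coord p)] _)]

end Charts


/-! ### Testing against decomposable bivectors, and the two implications -/

/-- The linear form on bivectors which sends `v ∧ w` to `⟨a, v⟩⟨b, w⟩ - ⟨a, w⟩⟨b, v⟩`. -/
def lorDual (a b : Mink) : Module.Dual ℝ Bivector :=
  exteriorPower.pairingDual ℝ Mink 2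
    (exteriorPower.ιMulti ℝ 2 ![(lorL a : Mink →ₗ[ℝ] ℝ), (lorL b : Mink →ₗ[ℝ] ℝ)])

theorem lorDual_wedge (a b v w : Mink) :
    lorDual a b (wedge v w) = lor a v * lor b w - lor a w * lor b v := by
  rw [lorDual, wedge, exteriorPower.pairingDual_ιMulti_ιMulti, Matrix.det_fin_two]
  simp [lorL_apply]
  ring

theorem lorDual_add_left (a a' b : Mink) : lorDual (a + a') b = lorDual a b + lorDual a' b := by
  simp only [lorDual, map_add, ContinuousLinearMap.toLinearMap_add]
  rw [AlternatingMap.map_vecCons_add, map_add]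

theorem lorDual_smul_left (c : ℝ) (a b : Mink) : lorDual (c • a) b = c • lorDual a b := by
  simp only [lorDual, map_smul, ContinuousLinearMap.toLinearMap_smul]
  rw [AlternatingMap.map_vecCons_smul, map_smul]

/-- The pairing of a bivector with `a ∧ b`, as a function of `a`. -/
def contraction (C : Bivector) (b : Mink) : Mink →L[ℝ] ℝ :=
  LinearMap.toContinuousLinearMap
    { toFun := fun a => lorDual a b C
      map_add' := fun a a' => by rw [lorDual_add_left, LinearMap.add_apply]
      map_smul' := fun c a => by rw [lorDual_smul_left]; rfl }

section Final

variable {M : Type*} [TopologicalSpace M] [ChartedSpace Plane M] [IsManifold (𝓡 2) ∞ M]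
  (hM : OrientedAtlas M) {x : M → Mink} (hx : IsSpacelikeSurface x)

include hM hx

theorem hasPointwiseOneTypeGaussMap_of_parallel (hH : ∀ p, meanCurvature x p ≠ 0)
    (h : HasParallelMeanCurvature x) : HasPointwiseOneTypeGaussMap x := by
  refine ⟨fun p => formNormSq (inChart x p) (coord p) + 2, fun p => ?_, 0, fun p => ?_⟩
  · have hX := isSpacelikeOn_chartDomain hx p
    have hp := coord_mem_chartDomain hx p
    exact contMDiffAt_of_inChart ((hX.contDiffAt_formNormSq hp).add contDiffAt_const)
      (hX.eventually hp fun w hw => congrArg (· + 2) (formNormSq_symm_apply hx hM hw))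
  · rw [laplaceEqAt_gaussMap_iff hx hM]
    intro ℓ
    have hX := isSpacelikeOn_chartDomain hx p
    have hp := coord_mem_chartDomain hx p
    have hD := fun w (hw : w ∈ chartDomain x p) =>
      normalPart_pd_meanVector_of_parallel hx hM h p hw
    rw [hX.laplace_gaussForm hp (wedgeForm_self ℓ), hD _ hp, hD _ hp,
      hX.sum_inv_mul_form_eq_zero hp (wedgeForm_self ℓ) hD (hH p)]
    simp [map_gaussMap]

theorem lorDual_self_eq_zero {f : M → ℝ} {C : Bivector}
    (h : ∀ p, LaplaceEqAt x (gaussMap x) p (f p • (gaussMap x p + C))) (p : M) (b : Mink) :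
    f p * lorDual (x p) b C = 0 := by
  have hX := isSpacelikeOn_chartDomain hx p
  have hp := coord_mem_chartDomain hx p
  have hxp : inChart x p (coord p) = x p := by simp [inChart, coord]
  have key := (laplaceEqAt_gaussMap_iff hx hM p _).1 (h p) (lorDual (x p) b)
  have h1 : ∀ k, lor (x p) (pd k (inChart x p) (coord p)) = 0 := hxp ▸ hX.lor_pd hp
  have h2 : ∀ w, lor (x p) (normalPart (inChart x p) (coord p) w) = 0 := fun w => by
    rw [lor_comm, ← hxp, hX.lor_normalPart_self hp]
  rw [hX.laplace_gaussForm hp (wedgeForm_self _), map_smul, map_add, map_gaussMap] at key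
  simpa [gaussForm, wedgeForm_apply, lorDual_wedge, secondForm, h1, h2] using key.symm

theorem hasParallelMeanCurvature_of_pointwiseOneType (h : HasPointwiseOneTypeGaussMap x) :
    HasParallelMeanCurvature x := by
  obtain ⟨f, hf, C, h⟩ := h
  rw [hasParallelMeanCurvature_iff hx hM]
  intro p k
  have hX := isSpacelikeOn_chartDomain hx p
  have hp := coord_mem_chartDomain hx p
  have hC : ∀ k b, f p * lorDual (pd k (inChart x p) (coord p)) b C = 0 := by
    intro k b
    by_cases hfp : f p = 0
    · simp [hfp]
    have hcont : ContinuousAt (fun u => f ((chartAt Plane p).symm u)) (coord p) :=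
      ContinuousAt.comp hf.continuous.continuousAt
        ((chartAt Plane p).continuousAt_symm (mem_chart_target Plane p))
    -- Near `p` the factor `f` can be divided out, leaving a relation between x and constants that
    -- is differentiable even though `f` was arbitrary.
    have hz : (fun u => contraction C b (inChart x p u)) =ᶠ[𝓝 (coord p)] fun _ => 0 := by
      have hne : f ((chartAt Plane p).symm (coord p)) ≠ 0 := by simpa [coord] using hfp
      filter_upwards [hcont.eventually_ne hne] with u hu
      exact (mul_eq_zero.1 (lorDual_self_eq_zero hM hx h ((chartAt Plane p).symm u) b)).resolve_left
        hu
    have hd := pd_congr (i := k) hz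
    rw [pd_const, pd, show (fun u => contraction C b (inChart x p u)) =
      contraction C b ∘ inChart x p from rfl,
      ((contraction C b).hasFDerivAt.comp _ (hX.diff hp).hasFDerivAt).fderiv] at hd
    exact mul_eq_zero_of_right _ hd
  have key := (laplaceEqAt_gaussMap_iff hx hM p _).1 (h p)
  simp only [map_smul, map_add, map_gaussMap, smul_eq_mul, mul_add] at key
  set X := inChart x p
  set u := coord p
  have hT : ∀ w k, lor (normalPart X u w) (pd k X u) = 0 := hX.lor_normalPart_pd hp
  have hT' : ∀ w k, lor (pd k X u) (normalPart X u w) = 0 := fun w k => by rw [lor_comm, hT]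
  have hd := hX.det_pos u hp
  have hs : (√(metric X u).det)⁻¹ ≠ 0 := inv_ne_zero (Real.sqrt_ne_zero'.2 hd)
  -- Against ∂ₖX ∧ ξ with ξ normal, the tangent and the normal bivectors and C all drop out of the
  -- equation.
  have eq : ∀ k y, metric X u k 0 * lor (normalPart X u y) (normalPart X u (pd 1 (meanVector X) u))
      = metric X u k 1 * lor (normalPart X u y) (normalPart X u (pd 0 (meanVector X) u)) := by
    intro k y
    replace key := key (lorDual (pd k X u) (normalPart X u y))
    rw [hX.laplace_gaussForm hp (wedgeForm_self _), hC] at key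
    simp [gaussForm, wedgeForm_apply, lorDual_wedge, secondForm, hT, hT',
      ← metric_apply] at key
    have := key.resolve_left (by simpa using hs)
    linarith
  have hn : ∀ k y, lor (normalPart X u y) (normalPart X u (pd k (meanVector X) u)) = 0 := by
    intro k y
    have e0 := eq 0 y
    have e1 := eq 1 y
    refine (mul_eq_zero.1 (?_ : (metric X u).det * _ = 0)).resolve_left hd.ne'
    rw [Matrix.det_fin_two]
    fin_cases k <;> simp only [Fin.zero_eta, Fin.mk_one]
    · linear_combination metric X u 1 0 * e0 - metric X u 0 0 * e1
    · linear_combination metric X u 1 1 * e0 - metric X u 0 1 * e1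
  by_contra hne
  -- The inner product is nondegenerate on the normal space, since a normal vector pairs with `y` as
  -- it does with the normal part of `y`.
  obtain ⟨y, hy⟩ := exists_lor_ne_zero hne
  refine hy ?_
  rw [← IsSpacelikeOn.lor_normalPart_of_orthogonal (hX.lor_normalPart_self hp _) (hT _), lor_comm,
    hn]

end Final

end

theorem mainTheorem2 {M : Type*} [TopologicalSpace M] [ChartedSpace Plane M]
    [IsManifold (𝓡 2) ∞ M] (hM : OrientedAtlas M)
    (x : M → Mink) (hx : IsSpacelikeSurface x) (hH : ∀ p, meanCurvature x p ≠ 0) :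
    HasPointwiseOneTypeGaussMap x ↔ HasParallelMeanCurvature x :=
  ⟨hasParallelMeanCurvature_of_pointwiseOneType hM hx,
    hasPointwiseOneTypeGaussMap_of_parallel hM hx hH⟩
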